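/- Let $G$ be the Barnes $G$-function, \[ G(z+1)=(2\pi)^{z/2}e^{-[z(z+1)+\gamma z^2]/2}\prod_{n=1}^\infty\Bigl[\Bigl(1+\frac zn\Bigr)^n e^{-z+z^2/(2n)}\Bigr], \] and for $z\neq 0$, $|\arg z|<\pi$, let $\log G(z+1)$ and $\log\Gamma(z+1)$ denote the analytic branches that are real for $z>0$ (equivalently, the continuations along the segment $[0,z]$ of the branches vanishing at $z=0$), and $\log z$ the principal logarithm. Let $B_n$ and $B_n(x)$ be the Bernoulli numbers and polynomials, let $\log A=\frac1{12}-\zeta'(-1)$ be the logarithm of the Glaisher–Kinkelin constant, and let $\mathrm{Li}_2(w)=\sum_{n\ge1}w^n/n^2$ for $|w|\le1$. For $N\ge 1$ define the remainder $R_N(z)$ by \[ \log G(z+1)=\tfrac14z^2+z\log\Gamma(z+1)-\Bigl(\tfrac12z(z+1)+\tfrac1{12}\Bigr)\log z-\log A+\sum_{n=1}^{N-1}\frac{B_{2n+2}}{2n(2n+1)(2n+2)z^{2n}}+R_N(z). \] Then for every integer $N\ge1$, \[ R_N(z)=\frac1{z^{2N}}\frac{(-1)^{N+1}}{\pi}\int_0^{+\infty}\Bigl(\int_0^1\frac{s^{2N-1}}{1+(st/z)^2}\,ds\Bigr)t^{2N}\log(1-e^{-2\pi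 t})\,dt =\frac1{z^{2N}}\frac{(-1)^{N}}{2\pi^2}\int_0^{+\infty}\frac{t^{2N-1}}{1+(t/z)^2}\,\mathrm{Li}_2(e^{-2\pi t})\,dt \] for $|\arg z|<\frac\pi2$, and \[ R_N(z)=-\frac1{2N(2N+1)}\int_0^{+\infty}\frac{B_{2N+1}(t-\lfloor t\rfloor)}{(t+z)^{2N}}\,dt =-\frac1{(2N+1)(2N+2)}\int_0^{+\infty}\frac{-B_{2N+2}+B_{2N+2}(t-\lfloor t\rfloor)}{(t+z)^{2N+1}}\,dt \] for $|\arg z|<\pi$, all integrals being absolutely convergent. -/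

import Mathlib

open Complex MeasureTheory Set

/-- The Barnes `G`-function, through its Weierstrass product in `z = w - 1`:
`G(z+1) = (2π)^{z/2} e^{-[z(z+1)+γz²]/2} ∏_{n≥1} (1+z/n)^n e^{-z+z²/(2n)}`
(the product is indexed from `0`, so that its `n`-th factor is the one for `n + 1`). -/
noncomputable def barnesG (w : ℂ) : ℂ :=
  ((2 * Real.pi : ℝ) : ℂ) ^ ((w - 1) / 2)
    * Complex.exp (-((w - 1) * ((w - 1) + 1)
        + (Real.eulerMascheroniConstant : ℂ) * (w - 1) ^ 2) / 2)
    * ∏' n : ℕ, ((1 + (w - 1) / ((n : ℂ) + 1)) ^ (n + 1)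
        * Complex.exp (-(w - 1) + (w - 1) ^ 2 / (2 * ((n : ℂ) + 1))))

/-- For `F` holomorphic and zero-free near the segment `[0, z]` with `F 0 = 1`: the value at `z` of
the logarithm of `F` that vanishes at `0` and is continued along the segment, i.e. the integral of
`F'/F` along `[0, z]`. -/
noncomputable def logBranch (F : ℂ → ℂ) (z : ℂ) : ℂ :=
  ∫ t in (0 : ℝ)..1, z * logDeriv F ((t : ℂ) * z)

/-- Under these hypotheses `logBranch F z` is a logarithm of `F z`. -/
theorem exp_logBranch {F : ℂ → ℂ} {U : Set ℂ} (hU : IsOpen U) (hF : DifferentiableOn ℂ F U)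
    (z : ℂ) (hseg : ∀ t ∈ Icc (0 : ℝ) 1, (t : ℂ) * z ∈ U)
    (hne : ∀ t ∈ Icc (0 : ℝ) 1, F ((t : ℂ) * z) ≠ 0) (h0 : F 0 = 1) :
    Complex.exp (logBranch F z) = F z := by
  set f : ℝ → ℂ := fun t => z * logDeriv F ((t : ℂ) * z) with hf
  set V : Set ℂ := U ∩ {w | F w ≠ 0} with hV
  have hVo : IsOpen V := hF.continuousOn.isOpen_inter_preimage hU isOpen_compl_singleton
  set S : Set ℝ := (fun t : ℝ => (t : ℂ) * z) ⁻¹' V with hS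
  have hcont : Continuous fun t : ℝ => (t : ℂ) * z := by fun_prop
  have hSo : IsOpen S := hVo.preimage hcont
  have hIS : Icc (0 : ℝ) 1 ⊆ S := fun t ht => ⟨hseg t ht, hne t ht⟩
  have hfc : ContinuousOn f S := by
    have h1 : ContinuousOn (logDeriv F) V :=
      ((hF.deriv hU).continuousOn.mono inter_subset_left).div
        (hF.continuousOn.mono inter_subset_left) (fun w hw => hw.2)
    exact continuousOn_const.mul (h1.comp hcont.continuousOn (fun t ht => ht))
  have hI : ∀ t ∈ Icc (0 : ℝ) 1, HasDerivAt (fun u => ∫ s in (0 : ℝ)..u, f s) (f t) t := by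
    intro t ht
    refine intervalIntegral.integral_hasDerivAt_right ?_
      (hfc.stronglyMeasurableAtFilter hSo t (hIS ht)) (hfc.continuousAt (hSo.mem_nhds (hIS ht)))
    refine (hfc.mono ?_).intervalIntegrable
    rw [uIcc_of_le ht.1]
    exact (Icc_subset_Icc_right ht.2).trans hIS
  have hφ : ∀ t ∈ Icc (0 : ℝ) 1,
      HasDerivAt (fun u : ℝ => F ((u : ℂ) * z)) (deriv F ((t : ℂ) * z) * z) t := by
    intro t ht
    have h1 : HasDerivAt F (deriv F ((t : ℂ) * z)) ((t : ℂ) * z) :=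
      ((hF _ (hseg t ht)).differentiableAt (hU.mem_nhds (hseg t ht))).hasDerivAt
    have h2 : HasDerivAt (fun u : ℝ => (u : ℂ) * z) z t := by
      simpa using (Complex.ofRealCLM.hasDerivAt (x := t)).mul_const z
    exact h1.comp t h2
  have hg : ∀ t ∈ Icc (0 : ℝ) 1, HasDerivAt
      (fun u : ℝ => F ((u : ℂ) * z) * Complex.exp (-∫ s in (0 : ℝ)..u, f s)) 0 t := by
    intro t ht
    refine ((hφ t ht).mul (hI t ht).neg.cexp).congr_deriv ?_
    have := hne t ht
    simp only [hf, logDeriv_apply]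
    field_simp
    ring
  have hc := constant_of_has_deriv_right_zero
    (fun t ht => (hg t ht).continuousAt.continuousWithinAt)
    (fun t ht => (hg t (Ico_subset_Icc_self ht)).hasDerivWithinAt) 1 (right_mem_Icc.2 zero_le_one)
  simp only [Complex.ofReal_one, one_mul, Complex.ofReal_zero, zero_mul, h0,
    intervalIntegral.integral_same, neg_zero, Complex.exp_zero, Complex.exp_neg] at hc
  have := Complex.exp_ne_zero (∫ s in (0 : ℝ)..1, f s)
  rw [mul_inv_eq_one₀ this] at hc
  exact hc.symm

/-- The branch of `log Γ(z+1)` on `|arg z| < π` that is real for `z > 0`. -/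
noncomputable def logGammaSucc (z : ℂ) : ℂ := logBranch (fun w => Complex.Gamma (w + 1)) z

/-- The branch of `log G(z+1)` on `|arg z| < π` that is real for `z > 0`. -/
noncomputable def logBarnesGSucc (z : ℂ) : ℂ := logBranch (fun w => barnesG (w + 1)) z

/-- The logarithm `log A = 1/12 - ζ'(-1)` of the Glaisher–Kinkelin constant. -/
noncomputable def logGlaisher : ℂ := 1 / 12 - deriv riemannZeta (-1)

/-- The dilogarithm `Li₂(w) = ∑_{n≥1} wⁿ/n²`, for `|w| ≤ 1`. -/
noncomputable def dilog (w : ℂ) : ℂ := ∑' n : ℕ, w ^ (n + 1) / ((n : ℂ) + 1) ^ 2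

/-- The remainder `R_N(z)` of the expansion of `log G(z+1)`. -/
noncomputable def barnesRemainder (N : ℕ) (z : ℂ) : ℂ :=
  logBarnesGSucc z
    - (z ^ 2 / 4 + z * logGammaSucc z - (z * (z + 1) / 2 + 1 / 12) * Complex.log z - logGlaisher
      + ∑ n ∈ Finset.Ico 1 N, (bernoulli (2 * n + 2) : ℂ)
          / (2 * (n : ℂ) * (2 * (n : ℂ) + 1) * (2 * (n : ℂ) + 2) * z ^ (2 * n)))

/-!
The difference `log G(z+1) - z log Γ(z+1)` is accessible to Euler–Maclaurin summation. On the cut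
plane both logarithms are the series of logarithms of the factors of the Weierstrass products
(`logBarnesGSucc_eq`, `logGammaSucc_eq`, from `logBranch_eq_add_tsum`), and the terms of the
difference are `(m + z) log (m + z)`, with third derivative `-(m + z)⁻²`, plus polynomials in `z`
with coefficients `log m`, `m log m`, `1` and `1/m`. Summation to
order three gives the remainder of order one as `-1/6 ∫ B₃({t}) / (t + z)²`
(`barnesRemainder_one`). The constants come from the asymptotics of `∑ 1/m`, `∑ log m`
(Stirling) and `∑ m log m`; the last one is `log A` because Euler–Maclaurin summation also continues
`ζ(s)` to `Re s > -2` and evaluates `ζ'(-1)` by the same integral at `z = 1`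
(`deriv_riemannZeta_neg_one`, `tendsto_sum_mul_log_sub`).

Integration by parts against periodized Bernoulli functions
(`integral_bernoulliFun_fract_div`) passes from the `B_{2N+1}` integral to the `B_{2N+2}` integral
and from `N` to `N + 1`, which gives both formulas on the cut plane.

In the right half-plane, the Fourier series of `B₄({t}) - B₄` is inserted into the `B₄` integral for
`N = 1`. Termwise, `∫ (1 - cos at) / (t + z)³ dt = (a²/2) ∫ t e^{-at} / (z² + t²) dt`
(`integral_one_sub_cos_div_cube`), since both sides are Laplace transforms of `x / (x² + a²)`, up to
a factor. Summing over `a = 2πn` produces `Li₂(e^{-2πt})`; general `N` follows by induction, as the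
moments of `Li₂(e^{-2πt})` are even zeta values (`integral_pow_mul_dilog`). The logarithmic formula
is an integration by parts away (`integral_mul_dilog_eq_neg_integral_mul_log`).
-/

/-! ### Periodized Bernoulli functions and Euler–Maclaurin summation -/

theorem measurable_bernoulliFun_fract (k : ℕ) :
    Measurable fun t : ℝ => (bernoulliFun k (Int.fract t) : ℂ) :=
  measurable_ofReal.comp ((continuous_bernoulliFun k).measurable.comp measurable_fract)

theorem exists_norm_bernoulliFun_fract_le (k : ℕ) :
    ∃ C : ℝ, 0 < C ∧ ∀ t : ℝ, ‖(bernoulliFun k (Int.fract t) : ℂ)‖ ≤ C := by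
  obtain ⟨C, hC⟩ := isCompact_Icc.exists_bound_of_continuousOn
    (continuous_bernoulliFun k).continuousOn (s := Icc (0 : ℝ) 1)
  refine ⟨|C| + 1, by positivity, fun t => ?_⟩
  rw [Complex.norm_real]
  exact (hC _ ⟨Int.fract_nonneg t, (Int.fract_lt_one t).le⟩).trans (by linarith [le_abs_self C])

theorem fract_eq_sub_natCast {n : ℕ} {t : ℝ} (ht : t ∈ Ioo (n : ℝ) (n + 1)) :
    Int.fract t = t - n := by
  rw [Int.fract_eq_iff]
  exact ⟨by linarith [ht.1], by linarith [ht.2], n, by simp⟩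

theorem hasDerivAt_bernoulliFun_ofReal (k : ℕ) (n t : ℝ) :
    HasDerivAt (fun t : ℝ => (bernoulliFun (k + 1) (t - n) : ℂ) / (k + 1))
      (bernoulliFun k (t - n) : ℂ) t := by
  have h := ((hasDerivAt_bernoulliFun (k + 1) (t - n)).comp_sub_const t n).ofReal_comp.div_const
    ((k : ℂ) + 1)
  refine h.congr_deriv ?_
  have : (k : ℂ) + 1 ≠ 0 := by exact_mod_cast k.succ_ne_zero
  push_cast [Nat.add_sub_cancel]
  field_simp

theorem intervalIntegrable_bernoulliFun_fract_mul (k : ℕ) {a b : ℝ} {f : ℝ → ℂ}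
    (hf : ContinuousOn f (uIcc a b)) :
    IntervalIntegrable (fun t => (bernoulliFun k (Int.fract t) : ℂ) * f t) volume a b := by
  obtain ⟨C, -, hC⟩ := exists_norm_bernoulliFun_fract_le k
  rw [intervalIntegrable_iff]
  exact (intervalIntegrable_iff.1 hf.intervalIntegrable).bdd_mul
    (measurable_bernoulliFun_fract k).aestronglyMeasurable (Filter.Eventually.of_forall hC)

/-- Integration by parts against a periodized Bernoulli function on one period. -/
theorem integral_bernoulliFun_fract_mul_unit (k n : ℕ) {f f' : ℝ → ℂ}
    (hf : ∀ t ∈ Icc (n : ℝ) (n + 1), HasDerivAt f (f' t) t)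
    (hf' : ContinuousOn f' (Icc (n : ℝ) (n + 1))) :
    ∫ t in (n : ℝ)..(n + 1), (bernoulliFun k (Int.fract t) : ℂ) * f t =
      (bernoulliFun (k + 1) 1 * f (n + 1) - bernoulliFun (k + 1) 0 * f n) / (k + 1)
        - 1 / (k + 1) * ∫ t in (n : ℝ)..(n + 1),
            (bernoulliFun (k + 1) (Int.fract t) : ℂ) * f' t := by
  have hle : (n : ℝ) ≤ n + 1 := by linarith
  have hU : uIcc (n : ℝ) (n + 1) = Icc (n : ℝ) (n + 1) := uIcc_of_le hle
  have hfr : ∀ (j : ℕ) (g : ℝ → ℂ),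
      ∫ t in (n : ℝ)..(n + 1), (bernoulliFun j (Int.fract t) : ℂ) * g t =
        ∫ t in (n : ℝ)..(n + 1), (bernoulliFun j (t - n) : ℂ) * g t := by
    intro j g
    simp only [intervalIntegral.integral_of_le hle, integral_Ioc_eq_integral_Ioo]
    refine setIntegral_congr_fun measurableSet_Ioo fun t ht => ?_
    simp only [fract_eq_sub_natCast ht]
  have hc : ∀ j, Continuous fun t : ℝ => (bernoulliFun j (t - n) : ℂ) := fun j =>
    continuous_ofReal.comp ((continuous_bernoulliFun j).comp (continuous_id.sub continuous_const))
  have h := intervalIntegral.integral_mul_deriv_eq_deriv_mul (a := (n : ℝ)) (b := n + 1)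
    (u := f) (u' := f') (v := fun t : ℝ => (bernoulliFun (k + 1) (t - n) : ℂ) / (k + 1))
    (v' := fun t : ℝ => (bernoulliFun k (t - n) : ℂ))
    (fun t ht => hf t (hU ▸ ht)) (fun t _ => hasDerivAt_bernoulliFun_ofReal k n t)
    (hU ▸ hf').intervalIntegrable (hc k).continuousOn.intervalIntegrable
  rw [hfr, hfr, ← intervalIntegral.integral_const_mul]
  simp only [mul_comm (f _)] at h
  rw [h]
  simp only [add_sub_cancel_left, sub_self]
  congr 1
  · ring
  · congr 1; ext t; ring

theorem sum_integral_natCast {g : ℝ → ℂ} (M : ℕ)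
    (hg : ∀ n < M, IntervalIntegrable g volume (n : ℝ) (n + 1)) :
    ∑ n ∈ Finset.range M, ∫ t in (n : ℝ)..(n + 1), g t = ∫ t in (0 : ℝ)..M, g t := by
  have := intervalIntegral.sum_integral_adjacent_intervals (μ := volume) (f := g)
    (a := fun n : ℕ => (n : ℝ)) (n := M) (by simpa using hg)
  simpa using this

theorem integral_bernoulliFun_fract_mul {k : ℕ} (hk : 1 ≤ k) (M : ℕ) {f f' : ℝ → ℂ}
    (hf : ∀ t, 0 ≤ t → HasDerivAt f (f' t) t) (hf' : ContinuousOn f' (Ici 0)) :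
    ∫ t in (0 : ℝ)..M, (bernoulliFun k (Int.fract t) : ℂ) * f t =
      bernoulli (k + 1) / (k + 1) * (f M - f 0)
        - 1 / (k + 1) * ∫ t in (0 : ℝ)..M, (bernoulliFun (k + 1) (Int.fract t) : ℂ) * f' t := by
  have hsub : ∀ n : ℕ, Icc (n : ℝ) (n + 1) ⊆ Ici 0 := fun n t ht =>
    le_trans (Nat.cast_nonneg n) ht.1
  have hcf : ContinuousOn f (Ici 0) := fun t ht => (hf t ht).continuousAt.continuousWithinAt
  have hi : ∀ (j n : ℕ) (g : ℝ → ℂ), ContinuousOn g (Ici 0) →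
      IntervalIntegrable (fun t => (bernoulliFun j (Int.fract t) : ℂ) * g t) volume n (n + 1) := by
    intro j n g hg
    refine intervalIntegrable_bernoulliFun_fract_mul j (hg.mono ?_)
    rw [uIcc_of_le (by linarith)]
    exact hsub n
  rw [← sum_integral_natCast M fun n _ => hi k n f hcf,
    ← sum_integral_natCast M fun n _ => hi (k + 1) n f' hf', Finset.mul_sum]
  rw [Finset.sum_congr rfl fun n _ => integral_bernoulliFun_fract_mul_unit k n
    (fun t ht => hf t (hsub n ht)) (hf'.mono (hsub n)), Finset.sum_sub_distrib]
  congr 1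
  have h1 : bernoulliFun (k + 1) 1 = bernoulli (k + 1) := by
    rw [bernoulliFun_endpoints_eq_of_ne_one (by omega), bernoulliFun_eval_zero]
  simp only [h1, bernoulliFun_eval_zero]
  have := Finset.sum_range_sub (fun n : ℕ => f n) M
  push_cast at this ⊢
  rw [← this, Finset.mul_sum]
  exact Finset.sum_congr rfl fun n _ => by ring

/-- Euler–Maclaurin summation on `[0, M]` with remainder of order three. -/
theorem sum_eq_integral_add_bernoulliFun_three (M : ℕ) {F f f₁ f₂ f₃ : ℝ → ℂ}
    (hF : ∀ t, 0 ≤ t → HasDerivAt F (f t) t)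
    (hf : ∀ t, 0 ≤ t → HasDerivAt f (f₁ t) t) (hf₁ : ∀ t, 0 ≤ t → HasDerivAt f₁ (f₂ t) t)
    (hf₂ : ∀ t, 0 ≤ t → HasDerivAt f₂ (f₃ t) t) (hf₃ : ContinuousOn f₃ (Ici 0)) :
    ∑ n ∈ Finset.range M, f (n + 1) =
      F M - F 0 + (f M - f 0) / 2 + (f₁ M - f₁ 0) / 12
        + 1 / 6 * ∫ t in (0 : ℝ)..M, (bernoulliFun 3 (Int.fract t) : ℂ) * f₃ t := by
  have hsub : ∀ n : ℕ, Icc (n : ℝ) (n + 1) ⊆ Ici 0 := fun n t ht =>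
    le_trans (Nat.cast_nonneg n) ht.1
  have hc : ∀ {g g' : ℝ → ℂ}, (∀ t, 0 ≤ t → HasDerivAt g (g' t) t) → ContinuousOn g (Ici 0) :=
    fun h t ht => (h t ht).continuousAt.continuousWithinAt
  have hsub' : uIcc (0 : ℝ) M ⊆ Ici 0 := by
    rw [uIcc_of_le (Nat.cast_nonneg M)]; exact Icc_subset_Ici_self
  have e0 : ∫ t in (0 : ℝ)..M, f t = F M - F 0 :=
    intervalIntegral.integral_eq_sub_of_hasDerivAt (fun t ht => hF t (hsub' ht))
      ((hc hf).mono hsub').intervalIntegrable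
  have e1 := integral_bernoulliFun_fract_mul le_rfl M hf₁ (hc hf₂)
  have e2 := integral_bernoulliFun_fract_mul one_le_two M hf₂ hf₃
  have hB2 : (bernoulli 2 : ℂ) = 1 / 6 := by rw [bernoulli_two]; norm_num
  have hB3 : (bernoulli 3 : ℂ) = 0 := by
    rw [bernoulli_eq_zero_of_odd (by decide) (by norm_num)]; norm_num
  have e3 : ∫ t in (0 : ℝ)..M, f t = ∑ n ∈ Finset.range M, (f n + f (n + 1)) / 2
      - ∫ t in (0 : ℝ)..M, (bernoulliFun 1 (Int.fract t) : ℂ) * f₁ t := by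
    have hU : ∀ n : ℕ, uIcc (n : ℝ) (n + 1) ⊆ Ici 0 := fun n => by
      rw [uIcc_of_le (by linarith)]; exact hsub n
    rw [← sum_integral_natCast M fun n _ => ((hc hf).mono (hU n)).intervalIntegrable,
      ← sum_integral_natCast M fun n _ =>
        intervalIntegrable_bernoulliFun_fract_mul 1 ((hc hf₁).mono (hU n)),
      ← Finset.sum_sub_distrib]
    refine Finset.sum_congr rfl fun n _ => ?_
    have := integral_bernoulliFun_fract_mul_unit 0 n (fun t ht => hf t (hsub n ht))
      ((hc hf₁).mono (hsub n))
    simp only [bernoulliFun_zero, bernoulliFun_one, zero_add] at this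
    norm_num at this
    simp only [bernoulliFun_one]
    push_cast
    rw [this]
    ring
  have e4 : ∑ n ∈ Finset.range M, (f n + f (n + 1)) / 2 =
      ∑ n ∈ Finset.range M, f (n + 1) - (f M - f 0) / 2 := by
    have := Finset.sum_range_sub (fun n : ℕ => f n) M
    push_cast at this
    rw [← this, Finset.sum_div, ← Finset.sum_sub_distrib]
    exact Finset.sum_congr rfl fun n _ => by ring
  norm_num [hB2, hB3, -bernoulliFun_one, -bernoulliFun_two] at e1 e2
  rw [e1, e2, e0, e4] at e3
  linear_combination -e3

theorem bernoulli_odd_cast (k : ℕ) : (bernoulli (2 * k + 3) : ℂ) = 0 := by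
  rw [bernoulli_eq_zero_of_odd ⟨k + 1, by ring⟩ (by omega)]; norm_num

/-! ### Integrals of periodized Bernoulli functions against inverse powers -/

theorem add_mem_slitPlane {z : ℂ} (hz : z ∈ slitPlane) {t : ℝ} (ht : 0 ≤ t) :
    (t : ℂ) + z ∈ slitPlane := by
  rw [mem_slitPlane_iff] at hz ⊢
  simp only [add_re, ofReal_re, add_im, ofReal_im, zero_add]
  exact hz.imp (fun h => by linarith) id

/-- The ray `z + [0, ∞)` stays away from `0`, at a distance comparable with `1 + t`. -/
theorem exists_le_norm_ofReal_add {z : ℂ} (hz : z ∈ slitPlane) :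
    ∃ c : ℝ, 0 < c ∧ ∀ t : ℝ, 0 ≤ t → c * (1 + t) ≤ ‖(t : ℂ) + z‖ := by
  obtain ⟨t₀, ht₀, hmin⟩ := (isCompact_Icc (a := (0 : ℝ)) (b := 2 * ‖z‖ + 1)).exists_isMinOn
    ⟨0, by constructor <;> positivity⟩
    (f := fun t : ℝ => ‖(t : ℂ) + z‖) (by fun_prop)
  set δ := ‖(t₀ : ℂ) + z‖
  have hδ : 0 < δ := norm_pos_iff.2 (slitPlane_ne_zero (add_mem_slitPlane hz ht₀.1))
  have hz0 := norm_nonneg z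
  refine ⟨min (δ / (2 * ‖z‖ + 2)) (1 / 4), by positivity, fun t ht => ?_⟩
  rcases le_total t (2 * ‖z‖ + 1) with h | h
  · calc _ ≤ δ / (2 * ‖z‖ + 2) * (2 * ‖z‖ + 2) :=
          mul_le_mul (min_le_left _ _) (by linarith) (by positivity) (by positivity)
      _ = δ := by field_simp
      _ ≤ _ := hmin ⟨ht, h⟩
  · have h1 : ‖(t : ℂ)‖ - ‖z‖ ≤ ‖(t : ℂ) + z‖ := by
      have := norm_sub_norm_le (t : ℂ) (-z)
      rwa [norm_neg, sub_neg_eq_add] at this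
    rw [Complex.norm_real, Real.norm_of_nonneg ht] at h1
    calc _ ≤ 1 / 4 * (1 + t) := by gcongr; exact min_le_right _ _
      _ ≤ _ := by linarith

theorem integrableOn_one_add_pow_inv {m : ℕ} (hm : 2 ≤ m) :
    IntegrableOn (fun t : ℝ => ((1 + t) ^ m)⁻¹) (Ioi 0) := by
  have h := integrableOn_add_rpow_Ioi_of_lt (a := -(m : ℝ)) (c := 0) (m := 1)
    (by have : (2 : ℝ) ≤ m := by exact_mod_cast hm
        linarith) (by norm_num)
  refine h.congr_fun (fun t ht => ?_) measurableSet_Ioi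
  have : 0 ≤ t + 1 := by linarith [mem_Ioi.1 ht]
  simp only [Real.rpow_neg this, Real.rpow_natCast, add_comm]

theorem continuousOn_add_pow_inv {z : ℂ} (hz : z ∈ slitPlane) (m : ℕ) :
    ContinuousOn (fun t : ℝ => (((t : ℂ) + z) ^ m)⁻¹) (Ici 0) :=
  ContinuousOn.inv₀ (by fun_prop) fun t ht =>
    pow_ne_zero _ (slitPlane_ne_zero (add_mem_slitPlane hz ht))

theorem integrableOn_add_pow_inv {z : ℂ} (hz : z ∈ slitPlane) {m : ℕ} (hm : 2 ≤ m) :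
    IntegrableOn (fun t : ℝ => (((t : ℂ) + z) ^ m)⁻¹) (Ioi 0) := by
  obtain ⟨c, hc, hle⟩ := exists_le_norm_ofReal_add hz
  refine ((integrableOn_one_add_pow_inv hm).const_mul (c ^ m)⁻¹).mono'
    (((continuousOn_add_pow_inv hz m).mono Ioi_subset_Ici_self).aestronglyMeasurable
      measurableSet_Ioi) ?_
  filter_upwards [ae_restrict_mem measurableSet_Ioi] with t ht
  have ht : 0 < t := ht
  rw [norm_inv, norm_pow, ← mul_inv, ← mul_pow]
  have := hle t ht.le
  gcongr

theorem integrableOn_bernoulliFun_fract_div (k : ℕ) {z : ℂ} (hz : z ∈ slitPlane) {m : ℕ}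
    (hm : 2 ≤ m) :
    IntegrableOn (fun t : ℝ => (bernoulliFun k (Int.fract t) : ℂ) / ((t : ℂ) + z) ^ m)
      (Ioi 0) := by
  obtain ⟨C, -, hC⟩ := exists_norm_bernoulliFun_fract_le k
  simp only [div_eq_mul_inv]
  exact (integrableOn_add_pow_inv hz hm).bdd_mul
    (measurable_bernoulliFun_fract k).aestronglyMeasurable (Filter.Eventually.of_forall hC)

theorem hasDerivAt_add_pow_inv {z : ℂ} (hz : z ∈ slitPlane) (m : ℕ) {t : ℝ} (ht : 0 ≤ t) :
    HasDerivAt (fun t : ℝ => (((t : ℂ) + z) ^ m)⁻¹) (-m * (((t : ℂ) + z) ^ (m + 1))⁻¹) t := by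
  have hne := slitPlane_ne_zero (add_mem_slitPlane hz ht)
  have h := (((hasDerivAt_id (t : ℂ)).add_const z).pow m).inv (pow_ne_zero m hne)
  have h := h.comp_ofReal
  refine h.congr_deriv ?_
  simp only [id]
  rcases m with _ | m
  · simp
  · push_cast
    simp only [Pi.pow_apply]
    field_simp
    ring

theorem tendsto_add_pow_inv {z : ℂ} (hz : z ∈ slitPlane) {m : ℕ} (hm : m ≠ 0) :
    Filter.Tendsto (fun M : ℕ => ((((M : ℝ) : ℂ) + z) ^ m)⁻¹) Filter.atTop (nhds 0) := by
  obtain ⟨c, hc, hle⟩ := exists_le_norm_ofReal_add hz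
  refine Filter.tendsto_inv₀_cobounded.comp ?_
  refine (tendsto_norm_atTop_iff_cobounded).1 ?_
  simp only [norm_pow]
  refine (Filter.tendsto_pow_atTop hm).comp ?_
  refine Filter.tendsto_atTop_mono (fun M : ℕ => hle M (Nat.cast_nonneg M)) ?_
  exact (Filter.tendsto_atTop_add_const_left _ _ tendsto_natCast_atTop_atTop).const_mul_atTop hc

theorem integral_add_pow_inv {z : ℂ} (hz : z ∈ slitPlane) {m : ℕ} (hm : 1 ≤ m) :
    ∫ t in Ioi (0 : ℝ), (((t : ℂ) + z) ^ (m + 1))⁻¹ = 1 / (m * z ^ m) := by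
  have hint := integrableOn_add_pow_inv hz (m := m + 1) (by omega)
  have hm0 : (m : ℂ) ≠ 0 := by exact_mod_cast (by omega : m ≠ 0)
  have h1 := intervalIntegral_tendsto_integral_Ioi 0 hint tendsto_natCast_atTop_atTop
  refine tendsto_nhds_unique h1 ?_
  have h2 : ∀ M : ℕ, ∫ t in (0 : ℝ)..M, (((t : ℂ) + z) ^ (m + 1))⁻¹ =
      -(1 / m) * ((((M : ℝ) : ℂ) + z) ^ m)⁻¹ + 1 / (m * z ^ m) := by
    intro M
    have hsub' : uIcc (0 : ℝ) M ⊆ Ici 0 := by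
      rw [uIcc_of_le (Nat.cast_nonneg M)]; exact Icc_subset_Ici_self
    rw [intervalIntegral.integral_eq_sub_of_hasDerivAt
      (f := fun t : ℝ => -(1 / (m : ℂ)) * (((t : ℂ) + z) ^ m)⁻¹)
      (fun t ht => ((hasDerivAt_add_pow_inv hz m (hsub' ht)).const_mul _).congr_deriv
        (by field_simp)) ((continuousOn_add_pow_inv hz _).mono hsub').intervalIntegrable]
    simp only [ofReal_zero, zero_add]
    field_simp
    ring
  simp only [h2]
  simpa using ((tendsto_add_pow_inv hz (m := m) (by omega)).const_mul (-(1 / (m : ℂ)))).add_const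
    (1 / (m * z ^ m))

/-- Integration by parts on `[0, ∞)`. -/
theorem integral_bernoulliFun_fract_div {k : ℕ} (hk : 1 ≤ k) {z : ℂ} (hz : z ∈ slitPlane) {m : ℕ}
    (hm : 2 ≤ m) :
    ∫ t in Ioi (0 : ℝ), (bernoulliFun k (Int.fract t) : ℂ) / ((t : ℂ) + z) ^ m =
      -(bernoulli (k + 1) / ((k + 1) * z ^ m))
        + m / (k + 1) * ∫ t in Ioi (0 : ℝ),
            (bernoulliFun (k + 1) (Int.fract t) : ℂ) / ((t : ℂ) + z) ^ (m + 1) := by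
  have h1 := intervalIntegral_tendsto_integral_Ioi 0 (integrableOn_bernoulliFun_fract_div k hz hm)
    tendsto_natCast_atTop_atTop
  have h2 := intervalIntegral_tendsto_integral_Ioi 0
    (integrableOn_bernoulliFun_fract_div (k + 1) hz (m := m + 1) (by omega))
    tendsto_natCast_atTop_atTop
  refine tendsto_nhds_unique h1 ?_
  have h3 : ∀ M : ℕ, ∫ t in (0 : ℝ)..M, (bernoulliFun k (Int.fract t) : ℂ) / ((t : ℂ) + z) ^ m =
      bernoulli (k + 1) / (k + 1) * (((((M : ℝ) : ℂ) + z) ^ m)⁻¹ - (z ^ m)⁻¹)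
        + m / (k + 1) * ∫ t in (0 : ℝ)..M,
            (bernoulliFun (k + 1) (Int.fract t) : ℂ) / ((t : ℂ) + z) ^ (m + 1) := by
    intro M
    have := integral_bernoulliFun_fract_mul hk M (fun t ht => hasDerivAt_add_pow_inv hz m ht)
      (continuousOn_const.mul (continuousOn_add_pow_inv hz (m + 1)))
    simp only [div_eq_mul_inv, mul_left_comm _ (-(m : ℂ)), intervalIntegral.integral_const_mul,
      ofReal_zero, zero_add] at this ⊢
    rw [this]
    ring
  simp only [h3]
  have h4 := (((tendsto_add_pow_inv hz (m := m) (by omega)).sub_const (z ^ m)⁻¹).const_mul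
    ((bernoulli (k + 1) : ℂ) / (k + 1))).add (h2.const_mul ((m : ℂ) / (k + 1)))
  convert h4 using 2
  have : z ^ m ≠ 0 := pow_ne_zero _ (slitPlane_ne_zero hz)
  have : (k : ℂ) + 1 ≠ 0 := by exact_mod_cast k.succ_ne_zero
  field_simp
  ring

/-! ### Logarithms of infinite products along segments -/

/-- If `F = exp (c + ∑ uₙ)` with a locally normally convergent series of holomorphic functions, then
the branch of `log F` continued along a segment is `c + ∑ uₙ`. -/
theorem logBranch_eq_add_tsum {F c : ℂ → ℂ} {u : ℕ → ℂ → ℂ} {V : Set ℂ} (hV : IsOpen V)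
    (hc : DifferentiableOn ℂ c V) (hu : ∀ n, DifferentiableOn ℂ (u n) V) {b : ℕ → ℝ}
    (hb : Summable b) {n₀ : ℕ} (hub : ∀ n, n₀ ≤ n → ∀ w ∈ V, ‖u n w‖ ≤ b n)
    (hF : ∀ w ∈ V, F w = Complex.exp (c w + ∑' n, u n w)) (h0 : c 0 + ∑' n, u n 0 = 0) {z : ℂ}
    (hz : ∀ t ∈ Icc (0 : ℝ) 1, (t : ℂ) * z ∈ V) :
    logBranch F z = c z + ∑' n, u n z := by
  set Φ : ℂ → ℂ := fun w => c w + ∑' n, u n w with hΦ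
  have hsum : ∀ w ∈ V, Summable fun n => u n w := fun w hw =>
    Summable.of_norm_bounded_eventually_nat hb
      (Filter.eventually_atTop.2 ⟨n₀, fun n hn => hub n hn w hw⟩)
  have hd : DifferentiableOn ℂ Φ V := by
    refine hc.add ?_
    have h1 : DifferentiableOn ℂ (fun w => ∑' n, u (n + n₀) w) V :=
      differentiableOn_tsum_of_summable_norm ((summable_nat_add_iff n₀).2 hb)
        (fun n => hu (n + n₀)) hV fun n w hw => hub _ (Nat.le_add_left _ _) w hw
    have h2 : DifferentiableOn ℂ (fun w => ∑ n ∈ Finset.range n₀, u n w) V :=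
      DifferentiableOn.fun_sum fun n _ => hu n
    exact (h2.add h1).congr fun w hw => ((hsum w hw).sum_add_tsum_nat_add n₀).symm
  have hlog : ∀ w ∈ V, logDeriv F w = deriv Φ w := by
    intro w hw
    have hev : F =ᶠ[nhds w] fun w => Complex.exp (Φ w) :=
      Filter.eventually_of_mem (hV.mem_nhds hw) hF
    have hdw := (hd w hw).differentiableAt (hV.mem_nhds hw)
    rw [logDeriv_apply, hev.deriv_eq, hdw.hasDerivAt.cexp.deriv, hF w hw, mul_div_cancel_left₀]
    exact Complex.exp_ne_zero _
  have hcont : Continuous fun t : ℝ => (t : ℂ) * z := by fun_prop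
  have hU : uIcc (0 : ℝ) 1 = Icc 0 1 := uIcc_of_le zero_le_one
  have hder : ∀ t ∈ uIcc (0 : ℝ) 1, HasDerivAt (fun t : ℝ => Φ ((t : ℂ) * z))
      (z * deriv Φ ((t : ℂ) * z)) t := by
    intro t ht
    rw [hU] at ht
    have h1 := ((hd _ (hz t ht)).differentiableAt (hV.mem_nhds (hz t ht))).hasDerivAt
    have h2 : HasDerivAt (fun u : ℝ => (u : ℂ) * z) z t := by
      simpa using (Complex.ofRealCLM.hasDerivAt (x := t)).mul_const z
    simpa [mul_comm, Function.comp_def] using h1.comp t h2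
  have hint : IntervalIntegrable (fun t : ℝ => z * deriv Φ ((t : ℂ) * z)) volume 0 1 := by
    refine ContinuousOn.intervalIntegrable (continuousOn_const.mul ?_)
    exact (hd.deriv hV).continuousOn.comp hcont.continuousOn fun t ht => hz t (hU ▸ ht)
  rw [logBranch, intervalIntegral.integral_congr (g := fun t : ℝ => z * deriv Φ ((t : ℂ) * z))
    fun t ht => by simp only [hlog _ (hz t (hU ▸ ht))],
    intervalIntegral.integral_eq_sub_of_hasDerivAt hder hint]
  simp [hΦ, h0]

theorem one_add_div_mem_slitPlane {w : ℂ} (hw : 1 + w ∈ slitPlane) (n : ℕ) :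
    1 + w / ((n : ℂ) + 1) ∈ slitPlane := by
  have hn : (0 : ℝ) < n + 1 := by positivity
  have h : (n : ℂ) + 1 = ((n + 1 : ℝ) : ℂ) := by push_cast; rfl
  rw [mem_slitPlane_iff] at hw ⊢
  rw [h]
  simp only [add_re, one_re, add_im, one_im, zero_add, div_ofReal_re, div_ofReal_im] at hw ⊢
  refine hw.imp (fun h => ?_) fun h => div_ne_zero h hn.ne'
  have h2 : 1 + w.re / (n + 1) = (n + (1 + w.re)) / (n + 1) := by field_simp; ring
  rw [h2]
  have : (0 : ℝ) ≤ n := Nat.cast_nonneg n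
  positivity

theorem one_add_mul_mem_slitPlane {z : ℂ} (hz : z ∈ slitPlane) {t : ℝ} (ht : t ∈ Icc (0 : ℝ) 1) :
    1 + (t : ℂ) * z ∈ slitPlane := by
  rw [mem_slitPlane_iff] at hz ⊢
  simp only [add_re, one_re, add_im, one_im, zero_add, re_ofReal_mul, im_ofReal_mul]
  rcases hz with h | h
  · left; have := mul_nonneg ht.1 h.le; linarith
  · rcases eq_or_lt_of_le ht.1 with h0 | h0
    · left; simp [← h0]
    · right; exact mul_ne_zero h0.ne' h

/-- The logarithm of the factor with index `n + 1` of the Weierstrass product of `G(z+1)`. -/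
noncomputable def barnesLogTerm (n : ℕ) (w : ℂ) : ℂ :=
  ((n : ℂ) + 1) * Complex.log (1 + w / ((n : ℂ) + 1)) - w + w ^ 2 / (2 * ((n : ℂ) + 1))

/-- The logarithm of the factor with index `n + 1` of the Weierstrass product of `Γ(z+1)`. -/
noncomputable def gammaLogTerm (n : ℕ) (w : ℂ) : ℂ :=
  w / ((n : ℂ) + 1) - Complex.log (1 + w / ((n : ℂ) + 1))

/-- The disc of radius `R` about `0`, cut along the singularities of `log Γ(z+1)`. -/
def cutDisc (R : ℝ) : Set ℂ := {w | 1 + w ∈ slitPlane ∧ ‖w‖ < R}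

theorem isOpen_cutDisc (R : ℝ) : IsOpen (cutDisc R) :=
  (isOpen_slitPlane.preimage (continuous_const.add continuous_id)).inter
    (isOpen_lt continuous_norm continuous_const)

theorem differentiableOn_log_one_add_div (R : ℝ) (n : ℕ) :
    DifferentiableOn ℂ (fun w : ℂ => Complex.log (1 + w / ((n : ℂ) + 1))) (cutDisc R) :=
  fun w hw => (DifferentiableAt.clog (f := fun w : ℂ => 1 + w / ((n : ℂ) + 1)) (by fun_prop)
    (one_add_div_mem_slitPlane hw.1 n)).differentiableWithinAt

theorem norm_div_succ_le {R : ℝ} {n : ℕ} (hn : ⌈2 * R⌉₊ ≤ n) {w : ℂ} (hw : ‖w‖ < R) :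
    ‖w / ((n : ℂ) + 1)‖ ≤ R / (n + 1) ∧ R / (n + 1) ≤ 1 / 2 := by
  have h1 : 2 * R ≤ n := (Nat.le_ceil _).trans (by exact_mod_cast hn)
  have hn0 : (0 : ℝ) < n + 1 := by positivity
  have h2 : ‖(n : ℂ) + 1‖ = n + 1 := by
    rw [show (n : ℂ) + 1 = ((n + 1 : ℝ) : ℂ) by push_cast; rfl, Complex.norm_real,
      Real.norm_of_nonneg hn0.le]
  rw [norm_div, h2]
  refine ⟨by gcongr, ?_⟩
  rw [div_le_iff₀ hn0]
  linarith

theorem norm_barnesLogTerm_le {R : ℝ} {n : ℕ} (hn : ⌈2 * R⌉₊ ≤ n) {w : ℂ} (hw : ‖w‖ < R) :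
    ‖barnesLogTerm n w‖ ≤ R ^ 3 * (1 / ((n : ℝ) + 1) ^ 2) := by
  obtain ⟨h1, h2⟩ := norm_div_succ_le hn hw
  have hn0 : (0 : ℝ) < n + 1 := by positivity
  have hn1 : (n : ℂ) + 1 ≠ 0 := by exact_mod_cast n.succ_ne_zero
  have h3 : ‖(n : ℂ) + 1‖ = n + 1 := by
    rw [show (n : ℂ) + 1 = ((n + 1 : ℝ) : ℂ) by push_cast; rfl, Complex.norm_real,
      Real.norm_of_nonneg hn0.le]
  set x := w / ((n : ℂ) + 1) with hx
  have h4 := norm_log_sub_logTaylor_le 2 (z := x) (by linarith)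
  have h5 : barnesLogTerm n w = ((n : ℂ) + 1) * (Complex.log (1 + x) - logTaylor 3 x) := by
    rw [barnesLogTerm, ← hx]
    simp [logTaylor_succ, logTaylor_zero]
    rw [hx]
    field_simp
    ring
  rw [h5, norm_mul, h3]
  have h6 : (1 - ‖x‖)⁻¹ ≤ 2 := by rw [inv_le_comm₀ (by linarith) two_pos]; linarith
  have h7 : ‖x‖ ^ (2 + 1) * (1 - ‖x‖)⁻¹ / ((2 : ℕ) + 1) ≤ ‖x‖ ^ 3 := by
    have : ‖x‖ ^ 3 * (1 - ‖x‖)⁻¹ ≤ ‖x‖ ^ 3 * 2 := by gcongr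
    norm_num at this ⊢
    have := pow_nonneg (norm_nonneg x) 3
    linarith
  calc _ ≤ (n + 1) * (R / (n + 1)) ^ 3 := by
        gcongr; exact h4.trans (h7.trans (by gcongr))
    _ = _ := by field_simp

theorem norm_gammaLogTerm_le {R : ℝ} {n : ℕ} (hn : ⌈2 * R⌉₊ ≤ n) {w : ℂ} (hw : ‖w‖ < R) :
    ‖gammaLogTerm n w‖ ≤ R ^ 2 * (1 / ((n : ℝ) + 1) ^ 2) := by
  obtain ⟨h1, h2⟩ := norm_div_succ_le hn hw
  rw [gammaLogTerm, norm_sub_rev]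
  set x := w / ((n : ℂ) + 1) with hx
  refine (norm_log_one_add_sub_self_le (z := x) (by linarith)).trans ?_
  have h6 : (1 - ‖x‖)⁻¹ ≤ 2 := by rw [inv_le_comm₀ (by linarith) two_pos]; linarith
  have h7 : ‖x‖ ^ 2 * (1 - ‖x‖)⁻¹ ≤ ‖x‖ ^ 2 * 2 := by gcongr
  calc _ ≤ ‖x‖ ^ 2 := by linarith
    _ ≤ (R / (n + 1)) ^ 2 := by gcongr
    _ = _ := by rw [div_pow, mul_one_div]

theorem summable_const_mul_one_div_succ_sq (C : ℝ) :
    Summable fun n : ℕ => C * (1 / ((n : ℝ) + 1) ^ 2) := by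
  have := (summable_nat_add_iff 1).2 (Real.summable_one_div_nat_pow.2 one_lt_two)
  push_cast at this
  exact this.mul_left C

theorem summable_barnesLogTerm (w : ℂ) : Summable fun n => barnesLogTerm n w :=
  Summable.of_norm_bounded_eventually_nat (summable_const_mul_one_div_succ_sq ((‖w‖ + 1) ^ 3))
    (Filter.eventually_atTop.2 ⟨_, fun _ hn => norm_barnesLogTerm_le hn (lt_add_one ‖w‖)⟩)

theorem summable_gammaLogTerm (w : ℂ) : Summable fun n => gammaLogTerm n w :=
  Summable.of_norm_bounded_eventually_nat (summable_const_mul_one_div_succ_sq ((‖w‖ + 1) ^ 2))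
    (Filter.eventually_atTop.2 ⟨_, fun _ hn => norm_gammaLogTerm_le hn (lt_add_one ‖w‖)⟩)

theorem barnesG_add_one_eq_exp {w : ℂ} (hw : 1 + w ∈ slitPlane) :
    barnesG (w + 1) = Complex.exp (((Real.log (2 * Real.pi) : ℝ) : ℂ) * w / 2
      - (w * (w + 1) + (Real.eulerMascheroniConstant : ℂ) * w ^ 2) / 2
      + ∑' n, barnesLogTerm n w) := by
  have h2pi : (0 : ℝ) < 2 * Real.pi := by positivity
  have hprod : ∀ n : ℕ, (1 + w / ((n : ℂ) + 1)) ^ (n + 1)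
      * Complex.exp (-w + w ^ 2 / (2 * ((n : ℂ) + 1))) = Complex.exp (barnesLogTerm n w) := by
    intro n
    have hne := slitPlane_ne_zero (one_add_div_mem_slitPlane hw n)
    have hlog := Complex.exp_nat_mul (Complex.log (1 + w / ((n : ℂ) + 1))) (n + 1)
    rw [Complex.exp_log hne] at hlog
    rw [← hlog, ← Complex.exp_add, barnesLogTerm]
    congr 1
    push_cast
    ring
  rw [barnesG]
  simp only [add_sub_cancel_right, hprod]
  have htp : ∏' n, Complex.exp (barnesLogTerm n w) = Complex.exp (∑' n, barnesLogTerm n w) :=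
    (summable_barnesLogTerm w).hasSum.cexp.tprod_eq
  rw [htp, Complex.cpow_def_of_ne_zero (by exact_mod_cast h2pi.ne'), ← Complex.ofReal_log h2pi.le,
    ← Complex.exp_add, ← Complex.exp_add]
  congr 1
  ring

theorem exp_sum_gammaLogTerm {w : ℂ} (hw : 1 + w ∈ slitPlane) (n : ℕ) :
    Complex.exp (∑ k ∈ Finset.range n, gammaLogTerm k w) =
      Complex.exp (w * (harmonic n : ℂ)) * (n.factorial : ℂ)
        / ∏ k ∈ Finset.range n, (w + 1 + k) := by
  induction n with
  | zero => simp
  | succ n ih =>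
    have hne := slitPlane_ne_zero (one_add_div_mem_slitPlane hw n)
    have hn1 : (n : ℂ) + 1 ≠ 0 := by exact_mod_cast n.succ_ne_zero
    have hfac : 1 + w / ((n : ℂ) + 1) = (w + 1 + n) / (n + 1) := by field_simp; ring
    rw [Finset.sum_range_succ, Complex.exp_add, ih, Finset.prod_range_succ, harmonic_succ,
      gammaLogTerm, Complex.exp_sub, Complex.exp_log hne, Nat.factorial_succ, hfac]
    push_cast
    rw [mul_add, Complex.exp_add, ← div_eq_mul_inv]
    rw [hfac] at hne
    have : w + 1 + n ≠ 0 := fun h => hne (by rw [h, zero_div])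
    field_simp

theorem tendsto_natCast_add_one_inv :
    Filter.Tendsto (fun n : ℕ => ((n : ℂ) + 1)⁻¹) Filter.atTop (nhds 0) := by
  have := (Complex.continuous_ofReal.tendsto 0).comp
    (tendsto_one_div_add_atTop_nhds_zero_nat (𝕜 := ℝ))
  simpa [Function.comp_def] using this

theorem Gamma_add_one_eq_exp {w : ℂ} (hw : 1 + w ∈ slitPlane) :
    Complex.Gamma (w + 1) = Complex.exp (-(Real.eulerMascheroniConstant : ℂ) * w
      + ∑' n, gammaLogTerm n w) := by
  have h1 := Complex.GammaSeq_tendsto_Gamma (w + 1)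
  have h2 : Filter.Tendsto (fun n : ℕ => Complex.exp (-(Real.eulerMascheroniConstant : ℂ) * w
      + ∑ k ∈ Finset.range (n + 1), gammaLogTerm k w)) Filter.atTop
      (nhds (Complex.exp (-(Real.eulerMascheroniConstant : ℂ) * w + ∑' n, gammaLogTerm n w))) :=
    (Complex.continuous_exp.tendsto _).comp
      (((summable_gammaLogTerm w).hasSum.tendsto_sum_nat.comp
        (Filter.tendsto_add_atTop_nat 1)).const_add _)
  -- the quotient of the two sequences is `exp (w (H_{n+1} - log n - γ)) * (n+1)/n → 1`
  have h3 : Filter.Tendsto (fun n : ℕ => ((((harmonic n : ℚ) : ℝ) - Real.log n : ℝ) : ℂ))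
      Filter.atTop (nhds (Real.eulerMascheroniConstant : ℂ)) :=
    (Complex.continuous_ofReal.tendsto _).comp Real.tendsto_harmonic_sub_log
  have h4 := tendsto_natCast_add_one_inv
  have h4' : Filter.Tendsto (fun n : ℕ => (n : ℂ)⁻¹) Filter.atTop (nhds 0) := by
    have := (Complex.continuous_ofReal.tendsto 0).comp (tendsto_inv_atTop_nhds_zero_nat (𝕜 := ℝ))
    simpa [Function.comp_def] using this
  have h5 : Filter.Tendsto (fun n : ℕ =>
      Complex.exp (w * (((((harmonic n : ℚ) : ℝ) - Real.log n : ℝ) : ℂ)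
        + ((n : ℂ) + 1)⁻¹ - Real.eulerMascheroniConstant)) * (1 + (n : ℂ)⁻¹))
      Filter.atTop (nhds 1) := by
    have := ((Complex.continuous_exp.tendsto _).comp
      (((h3.add h4).sub_const (Real.eulerMascheroniConstant : ℂ)).const_mul w)).mul
      (h4'.const_add 1)
    simpa [Function.comp_def] using this
  have h6 := h1.mul h5
  rw [mul_one] at h6
  refine tendsto_nhds_unique (h6.congr' ?_) h2
  filter_upwards [Filter.eventually_ge_atTop 1] with n hn
  have hn0 : (n : ℂ) ≠ 0 := by exact_mod_cast (by omega : n ≠ 0)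
  rw [Complex.exp_add, exp_sum_gammaLogTerm hw, Complex.GammaSeq,
    Complex.cpow_def_of_ne_zero hn0, harmonic_succ, Nat.factorial_succ,
    ← Complex.natCast_log]
  push_cast
  have e1 : Complex.exp (Complex.log n * (w + 1)) = n * Complex.exp (w * Complex.log n) := by
    rw [mul_add, Complex.exp_add, mul_one, Complex.exp_log hn0, mul_comm, mul_comm w]
  have e2 : Complex.exp (-(Real.eulerMascheroniConstant : ℂ) * w)
      * Complex.exp (w * ((harmonic n : ℂ) + ((n : ℂ) + 1)⁻¹)) =
      Complex.exp (w * Complex.log n) * Complex.exp (w * ((harmonic n : ℂ) - Complex.log n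
        + ((n : ℂ) + 1)⁻¹ - Real.eulerMascheroniConstant)) := by
    rw [← Complex.exp_add, ← Complex.exp_add]
    congr 1
    ring
  calc _ = (Complex.exp (w * Complex.log n) * Complex.exp (w * ((harmonic n : ℂ) - Complex.log n
        + ((n : ℂ) + 1)⁻¹ - Real.eulerMascheroniConstant))) * (((n : ℂ) + 1) * (n.factorial : ℂ)
        / ∏ j ∈ Finset.range (n + 1), (w + 1 + (j : ℂ))) := by rw [e1]; field_simp
    _ = _ := by rw [← e2]; ring

theorem mem_cutDisc_of_slitPlane {z : ℂ} (hz : z ∈ slitPlane) :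
    ∀ t ∈ Icc (0 : ℝ) 1, (t : ℂ) * z ∈ cutDisc (‖z‖ + 1) := by
  refine fun t ht => ⟨one_add_mul_mem_slitPlane hz ht, ?_⟩
  rw [norm_mul, Complex.norm_real, Real.norm_of_nonneg ht.1]
  nlinarith [norm_nonneg z, ht.2]

theorem logBarnesGSucc_eq {z : ℂ} (hz : z ∈ slitPlane) :
    logBarnesGSucc z = ((Real.log (2 * Real.pi) : ℝ) : ℂ) * z / 2
      - (z * (z + 1) + (Real.eulerMascheroniConstant : ℂ) * z ^ 2) / 2
      + ∑' n, barnesLogTerm n z :=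
  logBranch_eq_add_tsum (isOpen_cutDisc (‖z‖ + 1))
    (c := fun w => ((Real.log (2 * Real.pi) : ℝ) : ℂ) * w / 2
      - (w * (w + 1) + (Real.eulerMascheroniConstant : ℂ) * w ^ 2) / 2)
    (by fun_prop)
    (fun n => (((differentiableOn_log_one_add_div _ n).const_mul _).sub differentiableOn_id).add
      (by fun_prop))
    (summable_const_mul_one_div_succ_sq _) (fun _ hn _ hw => norm_barnesLogTerm_le hn hw.2)
    (fun _ hw => barnesG_add_one_eq_exp hw.1) (by simp)
    (mem_cutDisc_of_slitPlane hz)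

theorem logGammaSucc_eq {z : ℂ} (hz : z ∈ slitPlane) :
    logGammaSucc z = -(Real.eulerMascheroniConstant : ℂ) * z + ∑' n, gammaLogTerm n z :=
  logBranch_eq_add_tsum (isOpen_cutDisc (‖z‖ + 1))
    (c := fun w => -(Real.eulerMascheroniConstant : ℂ) * w) (by fun_prop)
    (fun n => DifferentiableOn.sub (by fun_prop) (differentiableOn_log_one_add_div _ n))
    (summable_const_mul_one_div_succ_sq _) (fun _ hn _ hw => norm_gammaLogTerm_le hn hw.2)
    (fun _ hw => Gamma_add_one_eq_exp hw.1) (by simp)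
    (mem_cutDisc_of_slitPlane hz)

/-! ### The derivative of the Riemann zeta function at `-1` -/

/-- The remainder integral of the Euler–Maclaurin continuation of `ζ(s)` to `Re s > -2`. -/
noncomputable def zetaKernel (s : ℂ) : ℂ :=
  ∫ t in Ioi (0 : ℝ), (bernoulliFun 3 (Int.fract t) : ℂ) * ((t : ℂ) + 1) ^ (-s - 3)

theorem zetaKernel_eq_mellin (s : ℂ) :
    zetaKernel s = mellin ((Ioi (1 : ℝ)).indicator fun t => (bernoulliFun 3 (Int.fract t) : ℂ))
      (-s - 2) := by
  have h1 := (measurePreserving_add_right volume (1 : ℝ)).setIntegral_preimage_emb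
    (measurableEmbedding_addRight (1 : ℝ))
    (fun t : ℝ => (bernoulliFun 3 (Int.fract t) : ℂ) * (t : ℂ) ^ (-s - 3)) (Ioi 1)
  have h2 : (fun x : ℝ => x + 1) ⁻¹' Ioi 1 = Ioi 0 := by ext; simp
  rw [h2] at h1
  simp only [Int.fract_add_one, ofReal_add, ofReal_one] at h1
  rw [zetaKernel, h1, mellin]
  have h3 : ∀ t : ℝ, (t : ℂ) ^ (-s - 2 - 1) •
      (Ioi (1 : ℝ)).indicator (fun t => (bernoulliFun 3 (Int.fract t) : ℂ)) t =
      (Ioi (1 : ℝ)).indicator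
        (fun t : ℝ => (bernoulliFun 3 (Int.fract t) : ℂ) * (t : ℂ) ^ (-s - 3)) t := by
    intro t
    by_cases ht : t ∈ Ioi (1 : ℝ)
    · rw [indicator_of_mem ht, indicator_of_mem ht, smul_eq_mul, mul_comm]
      congr 2; ring
    · rw [indicator_of_notMem ht, indicator_of_notMem ht, smul_zero]
  simp only [h3]
  rw [setIntegral_indicator measurableSet_Ioi]
  congr 2
  ext t
  simp only [mem_inter_iff, mem_Ioi]
  exact ⟨fun h => ⟨by linarith, h⟩, fun h => h.2⟩

theorem differentiableAt_zetaKernel {s : ℂ} (hs : -2 < s.re) :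
    DifferentiableAt ℂ zetaKernel s := by
  have hfun : zetaKernel = fun s => mellin
      ((Ioi (1 : ℝ)).indicator fun t => (bernoulliFun 3 (Int.fract t) : ℂ)) (-s - 2) :=
    funext zetaKernel_eq_mellin
  obtain ⟨C, hC0, hC⟩ := exists_norm_bernoulliFun_fract_le 3
  have hind : ∀ t, ‖(Ioi (1 : ℝ)).indicator (fun t => (bernoulliFun 3 (Int.fract t) : ℂ)) t‖ ≤ C :=
    fun t => (norm_indicator_le_norm_self _ _).trans (hC t)
  have hmeas : Measurable
      ((Ioi (1 : ℝ)).indicator fun t => (bernoulliFun 3 (Int.fract t) : ℂ)) :=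
    (measurable_bernoulliFun_fract 3).indicator measurableSet_Ioi
  rw [hfun]
  refine DifferentiableAt.comp s (g := mellin _) ?_ (by fun_prop)
  refine mellin_differentiableAt_of_isBigO_rpow (a := 0) (b := (-s - 2).re - 1) ?_ ?_ ?_ ?_ ?_
  · refine LocallyIntegrable.locallyIntegrableOn ?_ _
    exact (locallyIntegrable_const C).mono hmeas.aestronglyMeasurable
      (Filter.Eventually.of_forall fun t => (hind t).trans (le_abs_self C))
  · refine Asymptotics.IsBigO.of_bound C (Filter.Eventually.of_forall fun t => ?_)
    simpa using hind t
  · simp only [sub_re, neg_re, re_ofNat]; linarith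
  · refine Asymptotics.IsBigO.of_bound 1 ?_
    have h1 : Iio (1 : ℝ) ∈ nhdsWithin (0 : ℝ) (Ioi 0) :=
      mem_nhdsWithin_of_mem_nhds (Iio_mem_nhds one_pos)
    filter_upwards [h1] with t ht
    rw [indicator_of_notMem (show t ∉ Ioi (1 : ℝ) from not_lt.2 (mem_Iio.1 ht).le), norm_zero]
    positivity
  · linarith

theorem tendsto_natCast_add_one_cpow {a : ℂ} (ha : a.re < 0) :
    Filter.Tendsto (fun M : ℕ => (((M : ℝ) : ℂ) + 1) ^ a) Filter.atTop (nhds 0) := by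
  rw [tendsto_zero_iff_norm_tendsto_zero]
  have h1 : ∀ M : ℕ, ‖(((M : ℝ) : ℂ) + 1) ^ a‖ = ((M : ℝ) + 1) ^ a.re := by
    intro M
    rw [show ((M : ℝ) : ℂ) + 1 = ((M + 1 : ℝ) : ℂ) by push_cast; rfl,
      norm_cpow_eq_rpow_re_of_pos (by positivity)]
  simp only [h1]
  have h2 := tendsto_rpow_neg_atTop (y := -a.re) (by linarith)
  rw [neg_neg] at h2
  exact h2.comp (Filter.tendsto_atTop_add_const_right _ 1 tendsto_natCast_atTop_atTop)

/-- Euler–Maclaurin summation of `(t + 1)^{-s}` in the half-plane of absolute convergence. -/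
theorem riemannZeta_eq_zetaKernel {s : ℂ} (hs : 1 < s.re) :
    riemannZeta s = (s - 1)⁻¹ + 1 / 2 + s / 12 - s * (s + 1) * (s + 2) / 6 * zetaKernel s := by
  have hs1 : (1 : ℂ) - s ≠ 0 := by
    intro h
    have := congrArg re h
    simp only [sub_re, one_re, zero_re] at this
    linarith
  have hslit : ∀ t : ℝ, 0 ≤ t → (t : ℂ) + 1 ∈ slitPlane := fun t ht =>
    add_mem_slitPlane one_mem_slitPlane ht
  have hder : ∀ (c a : ℂ) (t : ℝ), 0 ≤ t →
      HasDerivAt (fun t : ℝ => c * ((t : ℂ) + 1) ^ a) (c * a * ((t : ℂ) + 1) ^ (a - 1)) t := by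
    intro c a t ht
    have := (((hasDerivAt_id (t : ℂ)).add_const 1).cpow_const (c := a)
      (hslit t ht)).comp_ofReal.const_mul c
    simpa [mul_assoc] using this
  have hcont : ∀ a : ℂ, ContinuousOn (fun t : ℝ => ((t : ℂ) + 1) ^ a) (Ici 0) := fun a =>
    ContinuousOn.cpow_const (by fun_prop) fun t ht => hslit t ht
  have hEM : ∀ M : ℕ, ∑ n ∈ Finset.range (M + 1), 1 / ((n : ℂ) + 1) ^ s =
      1 + (1 - s)⁻¹ * ((((M : ℝ) : ℂ) + 1) ^ (1 - s) - 1)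
        + ((((M : ℝ) : ℂ) + 1) ^ (-s) - 1) / 2 - s * ((((M : ℝ) : ℂ) + 1) ^ (-s - 1) - 1) / 12
        + 1 / 6 * (-(s * (s + 1) * (s + 2)) * ∫ t in (0 : ℝ)..M,
            (bernoulliFun 3 (Int.fract t) : ℂ) * ((t : ℂ) + 1) ^ (-s - 3)) := by
    intro M
    have h := sum_eq_integral_add_bernoulliFun_three M
      (F := fun t : ℝ => (1 - s)⁻¹ * ((t : ℂ) + 1) ^ (1 - s))
      (f := fun t : ℝ => 1 * ((t : ℂ) + 1) ^ (-s))
      (f₁ := fun t : ℝ => -s * ((t : ℂ) + 1) ^ (-s - 1))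
      (f₂ := fun t : ℝ => s * (s + 1) * ((t : ℂ) + 1) ^ (-s - 2))
      (f₃ := fun t : ℝ => -(s * (s + 1) * (s + 2)) * ((t : ℂ) + 1) ^ (-s - 3))
      (fun t ht => (hder _ _ t ht).congr_deriv (by
        rw [inv_mul_cancel₀ hs1]; congr 2; ring))
      (fun t ht => (hder _ _ t ht).congr_deriv (by rw [one_mul]))
      (fun t ht => (hder _ _ t ht).congr_deriv (by congr 1; ring_nf; congr 1; ring))
      (fun t ht => (hder _ _ t ht).congr_deriv (by congr 1; ring_nf; congr 1; ring))
      (continuousOn_const.mul (hcont _))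
    rw [Finset.sum_range_succ']
    simp only [ofReal_zero, zero_add, one_cpow, mul_left_comm _ (-(s * (s + 1) * (s + 2))),
      intervalIntegral.integral_const_mul, one_mul] at h
    simp only [one_div, ← cpow_neg, Nat.cast_zero, zero_add, one_cpow]
    push_cast at h ⊢
    rw [h]
    ring
  have hsum := (Complex.summable_one_div_nat_cpow (p := s)).2 hs
  have hsum' := ((summable_nat_add_iff 1).2 hsum).hasSum.tendsto_sum_nat
  push_cast at hsum'
  rw [← zeta_eq_tsum_one_div_nat_add_one_cpow hs] at hsum'
  have hlim := hsum'.comp (Filter.tendsto_add_atTop_nat 1)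
  refine tendsto_nhds_unique hlim ?_
  have hint : IntegrableOn (fun t : ℝ => (bernoulliFun 3 (Int.fract t) : ℂ)
      * ((t : ℂ) + 1) ^ (-s - 3)) (Ioi 0) := by
    obtain ⟨C, -, hC⟩ := exists_norm_bernoulliFun_fract_le 3
    refine Integrable.bdd_mul (c := C) ?_ (measurable_bernoulliFun_fract 3).aestronglyMeasurable
      (Filter.Eventually.of_forall hC)
    have h := integrableOn_add_rpow_Ioi_of_lt (a := -s.re - 3) (c := 0) (m := 1)
      (by linarith) (by norm_num)
    refine h.mono' (((hcont _).mono Ioi_subset_Ici_self).aestronglyMeasurable measurableSet_Ioi) ?_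
    filter_upwards [ae_restrict_mem measurableSet_Ioi] with t ht
    have ht : 0 < t := ht
    rw [show (t : ℂ) + 1 = ((t + 1 : ℝ) : ℂ) by push_cast; rfl,
      norm_cpow_eq_rpow_re_of_pos (by positivity)]
    simp
  have hJ := intervalIntegral_tendsto_integral_Ioi 0 hint tendsto_natCast_atTop_atTop
  have t1 := tendsto_natCast_add_one_cpow (a := 1 - s) (by simp; linarith)
  have t2 := tendsto_natCast_add_one_cpow (a := -s) (by simp; linarith)
  have t3 := tendsto_natCast_add_one_cpow (a := -s - 1) (by simp; linarith)
  have T := ((((((t1.sub_const 1).const_mul (1 - s)⁻¹).const_add 1).add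
    ((t2.sub_const 1).div_const 2)).sub (((t3.sub_const 1).const_mul s).div_const 12)).add
    ((hJ.const_mul (-(s * (s + 1) * (s + 2)))).const_mul (1 / 6)))
  simp only [Function.comp_def, hEM]
  convert T using 2
  rw [zetaKernel, show (s - 1)⁻¹ = -(1 - s)⁻¹ by rw [← inv_neg, neg_sub]]
  ring

/-- The formula for `ζ(s) - 1/(s-1)` persists for `Re s > -2` by analytic continuation. -/
theorem riemannZeta₀_eq_zetaKernel {s : ℂ} (hs : -2 < s.re) :
    riemannZeta₀ s = 1 / 2 + s / 12 - s * (s + 1) * (s + 2) / 6 * zetaKernel s := by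
  have hopen : IsOpen {s : ℂ | -2 < s.re} := isOpen_lt continuous_const continuous_re
  have h1 : DifferentiableOn ℂ riemannZeta₀ {s : ℂ | -2 < s.re} :=
    differentiable_riemannZeta₀.differentiableOn
  have h2 : DifferentiableOn ℂ (fun s => 1 / 2 + s / 12 - s * (s + 1) * (s + 2) / 6 * zetaKernel s)
      {s : ℂ | -2 < s.re} := fun s hs =>
    (DifferentiableAt.sub (by fun_prop)
      (DifferentiableAt.mul (by fun_prop) (differentiableAt_zetaKernel hs))).differentiableWithinAt
  refine AnalyticOnNhd.eqOn_of_preconnected_of_eventuallyEq (h1.analyticOnNhd hopen)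
    (h2.analyticOnNhd hopen) (convex_halfSpace_re_gt (-2)).isPreconnected (z₀ := 2)
    (by norm_num) ?_ hs
  filter_upwards [(isOpen_lt continuous_const continuous_re).mem_nhds
    (show (1 : ℝ) < (2 : ℂ).re by norm_num)] with w hw
  have hw1 : w ≠ 1 := by rintro rfl; simp at hw
  have := riemannZeta_eq_inv_sub_add hw1
  rw [riemannZeta_eq_zetaKernel hw] at this
  linear_combination -this

theorem deriv_riemannZeta_neg_one :
    deriv riemannZeta (-1) = -(1 / 6) + 1 / 6 * ∫ t in Ioi (0 : ℝ),
      (bernoulliFun 3 (Int.fract t) : ℂ) / ((t : ℂ) + 1) ^ 2 := by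
  have hre : (-2 : ℝ) < (-1 : ℂ).re := by norm_num
  have hk : zetaKernel (-1) = ∫ t in Ioi (0 : ℝ),
      (bernoulliFun 3 (Int.fract t) : ℂ) / ((t : ℂ) + 1) ^ 2 := by
    rw [zetaKernel]
    congr 1; ext t
    rw [show (-(-1) - 3 : ℂ) = -((2 : ℕ) : ℂ) by norm_num, cpow_neg, cpow_natCast, div_eq_mul_inv]
  rw [← hk]
  have hev : riemannZeta =ᶠ[nhds (-1)] fun s =>
      (s - 1)⁻¹ + (1 / 2 + s / 12 - (s + 1) * (s * (s + 2) / 6 * zetaKernel s)) := by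
    filter_upwards [(isOpen_lt continuous_const continuous_re).mem_nhds hre,
      isOpen_compl_singleton.mem_nhds (show (-1 : ℂ) ∈ ({1}ᶜ : Set ℂ) by norm_num)] with s hs hs1
    rw [riemannZeta_eq_inv_sub_add hs1, riemannZeta₀_eq_zetaKernel hs]
    ring
  rw [hev.deriv_eq]
  have hK : DifferentiableAt ℂ (fun s : ℂ => s * (s + 2) / 6 * zetaKernel s) (-1) :=
    DifferentiableAt.mul (by fun_prop) (differentiableAt_zetaKernel hre)
  have d1 := ((hasDerivAt_id (-1 : ℂ)).sub_const 1).inv (by norm_num)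
  have d2 := ((hasDerivAt_id (-1 : ℂ)).div_const 12).const_add (1 / 2)
  have d3 := ((hasDerivAt_id (-1 : ℂ)).add_const 1).mul hK.hasDerivAt
  have := (d1.add (d2.sub d3)).deriv
  refine Eq.trans this ?_
  simp only [id]
  norm_num
  ring

/-! ### The expansion of order one -/

/-- Euler–Maclaurin summation of `(t + z) log (t + z)`. -/
theorem sum_mul_log_eq {z : ℂ} (hz : z ∈ slitPlane) (M : ℕ) :
    ∑ n ∈ Finset.range M, ((n : ℂ) + 1 + z) * Complex.log ((n : ℂ) + 1 + z) =
      ((M : ℂ) + z) ^ 2 / 2 * Complex.log (M + z) - ((M : ℂ) + z) ^ 2 / 4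
        - (z ^ 2 / 2 * Complex.log z - z ^ 2 / 4)
        + (((M : ℂ) + z) * Complex.log (M + z) - z * Complex.log z) / 2
        + (Complex.log (M + z) - Complex.log z) / 12
        - 1 / 6 * ∫ t in (0 : ℝ)..M, (bernoulliFun 3 (Int.fract t) : ℂ) / ((t : ℂ) + z) ^ 2 := by
  have hid : ∀ t : ℝ, HasDerivAt (fun t : ℝ => (t : ℂ) + z) 1 t := fun t =>
    ((hasDerivAt_id (t : ℂ)).add_const z).comp_ofReal
  have hlog : ∀ t : ℝ, 0 ≤ t →
      HasDerivAt (fun t : ℝ => Complex.log ((t : ℂ) + z)) (((t : ℂ) + z)⁻¹) t := fun t ht =>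
    ((hid t).clog_real (add_mem_slitPlane hz ht)).congr_deriv (one_div _)
  have hne : ∀ t : ℝ, 0 ≤ t → (t : ℂ) + z ≠ 0 := fun t ht =>
    slitPlane_ne_zero (add_mem_slitPlane hz ht)
  have h := sum_eq_integral_add_bernoulliFun_three M
    (F := fun t : ℝ => ((t : ℂ) + z) ^ 2 / 2 * Complex.log ((t : ℂ) + z) - ((t : ℂ) + z) ^ 2 / 4)
    (f := fun t : ℝ => ((t : ℂ) + z) * Complex.log ((t : ℂ) + z))
    (f₁ := fun t : ℝ => Complex.log ((t : ℂ) + z) + 1)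
    (f₂ := fun t : ℝ => (((t : ℂ) + z) ^ 1)⁻¹)
    (f₃ := fun t : ℝ => -(1 : ℕ) * (((t : ℂ) + z) ^ (1 + 1))⁻¹)
    (fun t ht => by
      have h1 := ((((hid t).pow 2).div_const 2).mul (hlog t ht)).sub (((hid t).pow 2).div_const 4)
      refine h1.congr_deriv ?_
      have := hne t ht
      simp only [Pi.pow_apply]
      field_simp
      ring)
    (fun t ht => ((hid t).mul (hlog t ht)).congr_deriv (by have := hne t ht; field_simp))
    (fun t ht => ((hlog t ht).add_const 1).congr_deriv (by rw [pow_one]))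
    (fun t ht => hasDerivAt_add_pow_inv hz 1 ht)
    (continuousOn_const.mul (continuousOn_add_pow_inv hz 2))
  have hI : ∫ t in (0 : ℝ)..M, (bernoulliFun 3 (Int.fract t) : ℂ)
      * (-(1 : ℕ) * (((t : ℂ) + z) ^ (1 + 1))⁻¹) =
      -∫ t in (0 : ℝ)..M, (bernoulliFun 3 (Int.fract t) : ℂ) / ((t : ℂ) + z) ^ 2 := by
    rw [← intervalIntegral.integral_neg]
    congr 1; ext t
    push_cast
    ring
  rw [hI] at h
  push_cast at h
  rw [h]
  simp only [zero_add]
  ring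

/-- The Glaisher–Kinkelin constant as the constant term of the hyperfactorial asymptotics. -/
theorem tendsto_sum_mul_log_sub :
    Filter.Tendsto (fun M : ℕ => ∑ n ∈ Finset.range M, ((n : ℂ) + 1) * Complex.log ((n : ℂ) + 1)
      - (((M : ℂ) ^ 2 / 2 + M / 2 + 1 / 12) * Complex.log M - (M : ℂ) ^ 2 / 4))
      Filter.atTop (nhds logGlaisher) := by
  rw [← Filter.tendsto_add_atTop_iff_nat 1]
  have hJ := intervalIntegral_tendsto_integral_Ioi 0
    (integrableOn_bernoulliFun_fract_div 3 one_mem_slitPlane le_rfl) tendsto_natCast_atTop_atTop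
  have hT := (hJ.const_mul (1 / 6 : ℂ)).const_sub (1 / 4)
  have hlim : logGlaisher = 1 / 4 - 1 / 6 * ∫ t in Ioi (0 : ℝ),
      (bernoulliFun 3 (Int.fract t) : ℂ) / ((t : ℂ) + 1) ^ 2 := by
    rw [logGlaisher, deriv_riemannZeta_neg_one]; ring
  rw [hlim]
  refine hT.congr fun M => ?_
  have h := sum_mul_log_eq one_mem_slitPlane M
  rw [Finset.sum_range_succ']
  simp only [Complex.log_one] at h
  push_cast
  rw [h]
  simp only [zero_add, Complex.log_one]
  ring

theorem sum_log_eq_log_factorial (M : ℕ) :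
    ∑ n ∈ Finset.range M, Complex.log ((n : ℂ) + 1) = ((Real.log M.factorial : ℝ) : ℂ) := by
  induction M with
  | zero => simp
  | succ n ih =>
    rw [Finset.sum_range_succ, ih, Nat.factorial_succ, Nat.cast_mul, Real.log_mul
      (by positivity) (by positivity)]
    push_cast
    rw [add_comm]
    congr 1
    exact_mod_cast (Complex.natCast_log (n := n + 1)).symm

theorem tendsto_sum_log_sub :
    Filter.Tendsto (fun M : ℕ => ∑ n ∈ Finset.range M, Complex.log ((n : ℂ) + 1)
      - (((M : ℂ) + 1 / 2) * Complex.log M - M))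
      Filter.atTop (nhds (((Real.log (2 * Real.pi) : ℝ) : ℂ) / 2)) := by
  have h1 := (Real.continuousAt_log (by positivity : √Real.pi ≠ 0)).tendsto.comp
    Stirling.tendsto_stirlingSeq_sqrt_pi
  have h2 := (h1.add_const (Real.log 2 / 2))
  have h3 := (Complex.continuous_ofReal.tendsto _).comp h2
  have hlim : Real.log √Real.pi + Real.log 2 / 2 = Real.log (2 * Real.pi) / 2 := by
    rw [Real.log_sqrt Real.pi_pos.le, Real.log_mul two_ne_zero Real.pi_ne_zero]; ring
  rw [hlim] at h3
  push_cast at h3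
  refine h3.congr' ?_
  filter_upwards [Filter.eventually_ge_atTop 1] with M hM
  have hM0 : (0 : ℝ) < M := by exact_mod_cast hM
  rw [sum_log_eq_log_factorial, ← Complex.natCast_log]
  simp only [Function.comp_apply]
  rw [Stirling.log_stirlingSeq_formula, Real.log_div hM0.ne' (Real.exp_ne_zero _), Real.log_exp,
    Real.log_mul two_ne_zero hM0.ne']
  push_cast
  ring

theorem tendsto_sum_inv_sub :
    Filter.Tendsto (fun M : ℕ => ∑ n ∈ Finset.range M, ((n : ℂ) + 1)⁻¹ - Complex.log M)
      Filter.atTop (nhds (Real.eulerMascheroniConstant : ℂ)) := by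
  have h := (Complex.continuous_ofReal.tendsto _).comp Real.tendsto_harmonic_sub_log
  refine h.congr fun M => ?_
  simp only [Function.comp_apply]
  rw [← Complex.natCast_log, harmonic]
  push_cast
  rfl

theorem log_natCast_add_eq {z : ℂ} (hz : z ∈ slitPlane) (n : ℕ) :
    Complex.log ((n : ℂ) + 1 + z) = Complex.log ((n : ℂ) + 1)
      + Complex.log (1 + z / ((n : ℂ) + 1)) := by
  have h1 : (n : ℂ) + 1 = ((n + 1 : ℝ) : ℂ) := by push_cast; rfl
  have hn : (n : ℂ) + 1 ≠ 0 := by exact_mod_cast n.succ_ne_zero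
  have hw : 1 + z ∈ slitPlane := by simpa using add_mem_slitPlane hz zero_le_one
  have h2 := Complex.log_ofReal_mul (r := n + 1) (by positivity)
    (slitPlane_ne_zero (one_add_div_mem_slitPlane hw n))
  rw [← h1, mul_add, mul_one, mul_div_cancel₀ _ hn] at h2
  rw [h2, Complex.ofReal_log (by positivity), ← h1]

theorem tendsto_succ_mul_barnesLogTerm (z : ℂ) :
    Filter.Tendsto (fun n : ℕ => ((n : ℂ) + 1) * barnesLogTerm n z) Filter.atTop (nhds 0) := by
  have h := (tendsto_one_div_add_atTop_nhds_zero_nat (𝕜 := ℝ)).const_mul ((‖z‖ + 1) ^ 3)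
  rw [mul_zero] at h
  refine squeeze_zero_norm' ?_ h
  filter_upwards [Filter.eventually_ge_atTop ⌈2 * (‖z‖ + 1)⌉₊] with n hn
  have hn0 : (0 : ℝ) < n + 1 := by positivity
  rw [norm_mul, show (n : ℂ) + 1 = ((n + 1 : ℝ) : ℂ) by push_cast; rfl, Complex.norm_real,
    Real.norm_of_nonneg hn0.le]
  calc _ ≤ ((n : ℝ) + 1) * ((‖z‖ + 1) ^ 3 * (1 / ((n : ℝ) + 1) ^ 2)) := by
        gcongr; exact norm_barnesLogTerm_le hn (lt_add_one ‖z‖)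
    _ = _ := by field_simp

theorem tendsto_succ_mul_log (z : ℂ) :
    Filter.Tendsto (fun n : ℕ => ((n : ℂ) + 1) * Complex.log (1 + z / ((n : ℂ) + 1)) - z)
      Filter.atTop (nhds 0) := by
  have h4 := tendsto_natCast_add_one_inv
  have h := ((tendsto_succ_mul_barnesLogTerm z).mul h4).sub (h4.const_mul (z ^ 2 / 2))
  simp only [mul_zero, sub_zero] at h
  refine h.congr fun n => ?_
  have hn : (n : ℂ) + 1 ≠ 0 := by exact_mod_cast n.succ_ne_zero
  rw [barnesLogTerm]
  field_simp
  ring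

theorem tendsto_log_one_add_div_succ (z : ℂ) :
    Filter.Tendsto (fun n : ℕ => Complex.log (1 + z / ((n : ℂ) + 1))) Filter.atTop (nhds 0) := by
  have h4 := tendsto_natCast_add_one_inv
  have h := ((tendsto_succ_mul_log z).mul h4).add (h4.const_mul z)
  simp only [mul_zero, add_zero] at h
  refine h.congr fun n => ?_
  have hn : (n : ℂ) + 1 ≠ 0 := by exact_mod_cast n.succ_ne_zero
  field_simp
  ring

/-- The terms of `log G(z+1) - z log Γ(z+1)` are `(m + z) (log (m + z) - log m) - z - z²/(2m)`, so
the partial sums are evaluated by Euler–Maclaurin summation; the hyperfactorial, factorial and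
harmonic asymptotics cancel every divergent term and leave the constants of the expansion. -/
theorem barnesRemainder_one {z : ℂ} (hz : z ∈ slitPlane) :
    barnesRemainder 1 z = -(1 / 6) * ∫ t in Ioi (0 : ℝ),
      (bernoulliFun 3 (Int.fract t) : ℂ) / ((t : ℂ) + z) ^ 2 := by
  set g : ℂ := (Real.eulerMascheroniConstant : ℂ)
  set K : ℂ := ((Real.log (2 * Real.pi) : ℝ) : ℂ)
  have hA : Filter.Tendsto (fun n : ℕ => ∑ k ∈ Finset.range (n + 1), barnesLogTerm k z
      - z * ∑ k ∈ Finset.range (n + 1), gammaLogTerm k z) Filter.atTop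
      (nhds (∑' k, barnesLogTerm k z - z * ∑' k, gammaLogTerm k z)) :=
    (((summable_barnesLogTerm z).hasSum.tendsto_sum_nat).sub
      ((summable_gammaLogTerm z).hasSum.tendsto_sum_nat.const_mul z)).comp
      (Filter.tendsto_add_atTop_nat 1)
  have sh : ∀ {f : ℕ → ℂ} {a : ℂ}, Filter.Tendsto f Filter.atTop (nhds a) →
      Filter.Tendsto (fun n => f (n + 1)) Filter.atTop (nhds a) := fun h =>
    h.comp (Filter.tendsto_add_atTop_nat 1)
  have hJ := sh (intervalIntegral_tendsto_integral_Ioi 0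
    (integrableOn_bernoulliFun_fract_div 3 hz le_rfl) tendsto_natCast_atTop_atTop)
  have e1 := sh tendsto_sum_mul_log_sub
  have e2 := sh tendsto_sum_log_sub
  have e3 := sh tendsto_sum_inv_sub
  have l2 := tendsto_succ_mul_barnesLogTerm z
  have l1 := tendsto_succ_mul_log z
  have l0 := tendsto_log_one_add_div_succ z
  set J : ℂ := ∫ t in Ioi (0 : ℝ), (bernoulliFun 3 (Int.fract t) : ℂ) / ((t : ℂ) + z) ^ 2
  -- with `λ = log (1 + z/m)`, `m = n + 1`: `l2`, `l1`, `l0` control `m² λ`, `m λ` and `λ`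
  have T := (((((((l2.div_const 2).add (l1.const_mul (z + 1 / 2))).add
    (l0.const_mul (z ^ 2 / 2 + z / 2 + 1 / 12))).sub (hJ.const_mul (1 / 6))).sub
    (e2.const_mul z)).sub e1).sub (e3.const_mul (z ^ 2 / 2))).add_const
      (3 * z ^ 2 / 4 + z / 2 - (z ^ 2 / 2 + z / 2 + 1 / 12) * Complex.log z)
  have hU := tendsto_nhds_unique (T.congr fun n => ?_) hA
  · rw [barnesRemainder, logBarnesGSucc_eq hz, logGammaSucc_eq hz]
    simp only [Finset.Ico_self, Finset.sum_empty]
    linear_combination -hU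
  · have hn : (n : ℂ) + 1 ≠ 0 := by exact_mod_cast n.succ_ne_zero
    have hE := sum_mul_log_eq hz (n + 1)
    have hS : ∑ k ∈ Finset.range (n + 1), barnesLogTerm k z
        - z * ∑ k ∈ Finset.range (n + 1), gammaLogTerm k z =
        ∑ k ∈ Finset.range (n + 1), ((k : ℂ) + 1 + z) * Complex.log ((k : ℂ) + 1 + z)
        - ∑ k ∈ Finset.range (n + 1), ((k : ℂ) + 1) * Complex.log ((k : ℂ) + 1)
        - z * ∑ k ∈ Finset.range (n + 1), Complex.log ((k : ℂ) + 1)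
        - z ^ 2 / 2 * ∑ k ∈ Finset.range (n + 1), ((k : ℂ) + 1)⁻¹
        - ∑ k ∈ Finset.range (n + 1), z := by
      simp only [Finset.mul_sum, ← Finset.sum_sub_distrib]
      refine Finset.sum_congr rfl fun k _ => ?_
      have hk : (k : ℂ) + 1 ≠ 0 := by exact_mod_cast k.succ_ne_zero
      rw [log_natCast_add_eq hz, barnesLogTerm, gammaLogTerm]
      field_simp
      ring
    rw [hS, hE, Finset.sum_const, Finset.card_range, nsmul_eq_mul, barnesLogTerm]
    push_cast
    rw [log_natCast_add_eq hz]
    field_simp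
    ring

/-! ### The remainder as an integral of periodized Bernoulli functions -/

theorem barnesRemainder_succ {N : ℕ} (hN : 1 ≤ N) (z : ℂ) :
    barnesRemainder (N + 1) z = barnesRemainder N z - (bernoulli (2 * N + 2) : ℂ)
      / (2 * (N : ℂ) * (2 * (N : ℂ) + 1) * (2 * (N : ℂ) + 2) * z ^ (2 * N)) := by
  rw [barnesRemainder, barnesRemainder, Finset.sum_Ico_succ_top hN]
  ring

theorem integral_bernoulliFun_odd_div {N : ℕ} (hN : 1 ≤ N) {z : ℂ} (hz : z ∈ slitPlane) :
    ∫ t in Ioi (0 : ℝ), (bernoulliFun (2 * N + 1) (Int.fract t) : ℂ) / ((t : ℂ) + z) ^ (2 * N) =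
      -(bernoulli (2 * N + 2) / ((2 * N + 2) * z ^ (2 * N)))
        + 2 * N / (2 * N + 2) * ∫ t in Ioi (0 : ℝ),
          (bernoulliFun (2 * N + 2) (Int.fract t) : ℂ) / ((t : ℂ) + z) ^ (2 * N + 1) := by
  have h := integral_bernoulliFun_fract_div (k := 2 * N + 1) (by omega) hz (m := 2 * N) (by omega)
  rw [h]
  push_cast
  ring

/-- Two integrations by parts raise `N` by one; the boundary terms with odd Bernoulli numbers
vanish. -/
theorem barnesRemainder_eq_integral_odd {N : ℕ} (hN : 1 ≤ N) {z : ℂ} (hz : z ∈ slitPlane) :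
    barnesRemainder N z = -(1 / (2 * (N : ℂ) * (2 * (N : ℂ) + 1)))
      * ∫ t in Ioi (0 : ℝ), (bernoulliFun (2 * N + 1) (Int.fract t) : ℂ)
        / ((t : ℂ) + z) ^ (2 * N) := by
  induction N, hN using Nat.le_induction with
  | base => rw [barnesRemainder_one hz]; norm_num
  | succ N hN ih =>
    have h2 := integral_bernoulliFun_fract_div (k := 2 * N + 2) (by omega) hz (m := 2 * N + 1)
      (by omega)
    rw [barnesRemainder_succ hN, ih, integral_bernoulliFun_odd_div hN hz, h2,
      show 2 * N + 2 + 1 = 2 * (N + 1) + 1 by ring, show 2 * N + 1 + 1 = 2 * (N + 1) by ring,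
      show 2 * (N + 1) + 1 = 2 * N + 3 by ring, bernoulli_odd_cast]
    have hN0 : (N : ℂ) ≠ 0 := by exact_mod_cast (by omega : N ≠ 0)
    have h1 : (2 * (N : ℂ) + 1) ≠ 0 := by exact_mod_cast (by omega : 2 * N + 1 ≠ 0)
    have h3 : (N : ℂ) + 1 ≠ 0 := by exact_mod_cast (by omega : N + 1 ≠ 0)
    have h4 : (2 * (N : ℂ) + 2 + 1) ≠ 0 := by exact_mod_cast (by omega : 2 * N + 2 + 1 ≠ 0)
    have h5 : (2 * ((N : ℂ) + 1) + 1) ≠ 0 := by exact_mod_cast (by omega : 2 * (N + 1) + 1 ≠ 0)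
    have hz0 : z ≠ 0 := slitPlane_ne_zero hz
    have h6 : (2 * (N : ℂ) + 2) ≠ 0 := by exact_mod_cast (by omega : 2 * N + 2 ≠ 0)
    push_cast
    generalize ∫ t in Ioi (0 : ℝ), (bernoulliFun (2 * N + 3) (Int.fract t) : ℂ)
      / ((t : ℂ) + z) ^ (2 * (N + 1)) = I
    rw [show 2 * ((N : ℂ) + 1) + 1 = 2 * N + 2 + 1 by ring]
    field_simp
    ring

theorem integrableOn_bernoulliFun_sub_div (k : ℕ) (c : ℂ) {z : ℂ} (hz : z ∈ slitPlane) {m : ℕ}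
    (hm : 2 ≤ m) :
    IntegrableOn (fun t : ℝ => (-c + (bernoulliFun k (Int.fract t) : ℂ)) / ((t : ℂ) + z) ^ m)
      (Ioi 0) := by
  simp only [add_div, div_eq_mul_inv (-c)]
  exact ((integrableOn_add_pow_inv hz hm).const_mul _).add
    (integrableOn_bernoulliFun_fract_div k hz hm)

theorem barnesRemainder_eq_integral_even {N : ℕ} (hN : 1 ≤ N) {z : ℂ} (hz : z ∈ slitPlane) :
    barnesRemainder N z = -(1 / ((2 * (N : ℂ) + 1) * (2 * (N : ℂ) + 2)))
      * ∫ t in Ioi (0 : ℝ), (-(bernoulli (2 * N + 2) : ℂ)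
          + (bernoulliFun (2 * N + 2) (Int.fract t) : ℂ)) / ((t : ℂ) + z) ^ (2 * N + 1) := by
  have hI : ∫ t in Ioi (0 : ℝ), (-(bernoulli (2 * N + 2) : ℂ)
      + (bernoulliFun (2 * N + 2) (Int.fract t) : ℂ)) / ((t : ℂ) + z) ^ (2 * N + 1) =
      -(bernoulli (2 * N + 2) : ℂ) * (1 / (((2 * N : ℕ) : ℂ) * z ^ (2 * N)))
        + ∫ t in Ioi (0 : ℝ), (bernoulliFun (2 * N + 2) (Int.fract t) : ℂ)
          / ((t : ℂ) + z) ^ (2 * N + 1) := by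
    simp only [add_div, div_eq_mul_inv (-(bernoulli (2 * N + 2) : ℂ))]
    rw [integral_add ((integrableOn_add_pow_inv hz (by omega)).const_mul _)
      (integrableOn_bernoulliFun_fract_div _ hz (by omega)), integral_const_mul,
      integral_add_pow_inv hz (by omega)]
  rw [barnesRemainder_eq_integral_odd hN hz, integral_bernoulliFun_odd_div hN hz, hI]
  have hN0 : (N : ℂ) ≠ 0 := by exact_mod_cast (by omega : N ≠ 0)
  have h1 : (2 * (N : ℂ) + 1) ≠ 0 := by exact_mod_cast (by omega : 2 * N + 1 ≠ 0)
  have h3 : (N : ℂ) + 1 ≠ 0 := by exact_mod_cast (by omega : N + 1 ≠ 0)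
  have hz0 : z ≠ 0 := slitPlane_ne_zero hz
  have h6 : (2 * (N : ℂ) + 2) ≠ 0 := by exact_mod_cast (by omega : 2 * N + 2 ≠ 0)
  push_cast
  field_simp

/-! ### Laplace transforms -/

theorem integrableOn_pow_mul_exp_neg (m : ℕ) {b : ℝ} (hb : 0 < b) :
    IntegrableOn (fun t : ℝ => t ^ m * Real.exp (-(b * t))) (Ioi 0) := by
  have h := integrableOn_rpow_mul_exp_neg_mul_rpow (p := 1) (s := m) (b := b)
    (by have : (0 : ℝ) ≤ m := Nat.cast_nonneg m
        linarith) one_pos hb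
  simpa using h

theorem integral_exp_neg_mul_exp_mul_I {w : ℂ} (hw : 0 < w.re) (a : ℝ) :
    ∫ x in Ioi (0 : ℝ), Complex.exp (-w * x) * Complex.exp (a * x * I) = 1 / (w - a * I) := by
  have hre : (-w + a * I).re < 0 := by simp; linarith
  have h := integral_exp_mul_complex_Ioi hre 0
  have hne : w - a * I ≠ 0 := by
    intro h0
    have : -w + a * I = 0 := by linear_combination -h0
    rw [this] at hre
    simp at hre
  simp only [← Complex.exp_add]
  rw [show 1 / (w - a * I) = -Complex.exp ((-w + a * I) * (0 : ℝ)) / (-w + a * I) by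
    rw [show -w + a * I = -(w - a * I) by ring, neg_div_neg_eq]; simp, ← h]
  congr 1; ext x; ring_nf

theorem integrableOn_exp_neg_mul_exp_mul_I {w : ℂ} (hw : 0 < w.re) (a : ℝ) :
    IntegrableOn (fun x : ℝ => Complex.exp (-w * x) * Complex.exp (a * x * I)) (Ioi 0) := by
  have hre : (-w + a * I).re < 0 := by simp; linarith
  refine (integrableOn_exp_mul_complex_Ioi hre 0).congr_fun (fun x _ => ?_) measurableSet_Ioi
  simp only [← Complex.exp_add]
  ring_nf

theorem sq_add_sq_ne_zero {w : ℂ} (hw : 0 < w.re) (a : ℝ) : w ^ 2 + (a : ℂ) ^ 2 ≠ 0 := by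
  have h : w ^ 2 + (a : ℂ) ^ 2 = (w - a * I) * (w + a * I) := by
    linear_combination (a : ℂ) ^ 2 * I_sq
  rw [h]
  refine mul_ne_zero ?_ ?_ <;>
  · intro h0
    have := congrArg re h0
    simp at this
    linarith

theorem integral_exp_neg_mul_sin {w : ℂ} (hw : 0 < w.re) (a : ℝ) :
    ∫ x in Ioi (0 : ℝ), Complex.exp (-w * x) * (Real.sin (a * x) : ℂ) = a / (w ^ 2 + a ^ 2) := by
  have h1 := integral_exp_neg_mul_exp_mul_I hw a
  have h2 := integral_exp_neg_mul_exp_mul_I hw (-a)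
  have i1 := integrableOn_exp_neg_mul_exp_mul_I hw a
  have i2 := integrableOn_exp_neg_mul_exp_mul_I hw (-a)
  have h : ∀ x : ℝ, Complex.exp (-w * x) * (Real.sin (a * x) : ℂ) =
      (Complex.exp (-w * x) * Complex.exp ((-a : ℝ) * x * I)
        - Complex.exp (-w * x) * Complex.exp (a * x * I)) * (I / 2) := by
    intro x
    rw [Complex.ofReal_sin, Complex.sin]
    push_cast
    ring_nf
  simp only [h]
  rw [integral_mul_const, integral_sub i2 i1, h1, h2]
  have hne := sq_add_sq_ne_zero hw a
  have hf : w ^ 2 + (a : ℂ) ^ 2 = (w - a * I) * (w + a * I) := by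
    linear_combination (a : ℂ) ^ 2 * I_sq
  rw [hf] at hne ⊢
  have := left_ne_zero_of_mul hne
  have := right_ne_zero_of_mul hne
  push_cast
  rw [show w - -(a : ℂ) * I = w + a * I by ring]
  field_simp
  linear_combination (-2 * (a : ℂ)) * I_sq

theorem integral_exp_neg_mul_one_sub_cos {w : ℂ} (hw : 0 < w.re) (a : ℝ) :
    ∫ x in Ioi (0 : ℝ), Complex.exp (-w * x) * (1 - Real.cos (a * x) : ℝ) =
      a ^ 2 / (w * (w ^ 2 + a ^ 2)) := by
  have h1 := integral_exp_neg_mul_exp_mul_I hw a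
  have h2 := integral_exp_neg_mul_exp_mul_I hw (-a)
  have h3 := integral_exp_neg_mul_exp_mul_I hw 0
  have i1 := integrableOn_exp_neg_mul_exp_mul_I hw a
  have i2 := integrableOn_exp_neg_mul_exp_mul_I hw (-a)
  have i3 := integrableOn_exp_neg_mul_exp_mul_I hw 0
  have h : ∀ x : ℝ, Complex.exp (-w * x) * (1 - Real.cos (a * x) : ℝ) =
      Complex.exp (-w * x) * Complex.exp ((0 : ℝ) * x * I)
        - (Complex.exp (-w * x) * Complex.exp ((-a : ℝ) * x * I)
        + Complex.exp (-w * x) * Complex.exp (a * x * I)) * (1 / 2) := by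
    intro x
    push_cast
    rw [Complex.cos]
    simp only [zero_mul, Complex.exp_zero]
    ring_nf
  simp only [h]
  rw [integral_sub i3 (by simpa using (i2.add i1).mul_const (1 / 2)), integral_mul_const,
    integral_add i2 i1, h1, h2, h3]
  have hne := sq_add_sq_ne_zero hw a
  have hf : w ^ 2 + (a : ℂ) ^ 2 = (w - a * I) * (w + a * I) := by
    linear_combination (a : ℂ) ^ 2 * I_sq
  have hw0 : w ≠ 0 := by rintro rfl; simp at hw
  rw [hf] at hne ⊢
  have := left_ne_zero_of_mul hne
  have := right_ne_zero_of_mul hne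
  push_cast
  rw [show w - -(a : ℂ) * I = w + a * I by ring, show w - 0 * I = w by ring]
  field_simp
  linear_combination (-2 * (a : ℂ) ^ 2) * I_sq

theorem integral_sq_mul_exp_neg {w : ℂ} (hw : 0 < w.re) :
    ∫ x in Ioi (0 : ℝ), (x : ℂ) ^ 2 * Complex.exp (-(w * x)) = 2 / w ^ 3 := by
  have hw0 : w ≠ 0 := by rintro rfl; simp at hw
  have hexp : ∀ x : ℝ, ‖Complex.exp (-(w * x))‖ = Real.exp (-(w.re * x)) := fun x => by
    rw [Complex.norm_exp]; simp
  have hlim : ∀ k : ℕ, Filter.Tendsto (fun x : ℝ => (x : ℂ) ^ k * Complex.exp (-(w * x)))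
      Filter.atTop (nhds 0) := by
    intro k
    rw [tendsto_zero_iff_norm_tendsto_zero]
    have h := tendsto_rpow_mul_exp_neg_mul_atTop_nhds_zero k w.re hw
    refine h.congr' ?_
    filter_upwards [Filter.eventually_ge_atTop 0] with x hx
    rw [norm_mul, hexp, norm_pow, Complex.norm_real, Real.norm_of_nonneg hx, Real.rpow_natCast,
      neg_mul]
  have hder : ∀ x : ℝ, HasDerivAt (fun x : ℝ => -((x : ℂ) ^ 2 / w + 2 * x / w ^ 2 + 2 / w ^ 3)
      * Complex.exp (-(w * x))) ((x : ℂ) ^ 2 * Complex.exp (-(w * x))) x := by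
    intro x
    have d := hasDerivAt_id (x : ℂ)
    have h := (((((d.pow 2).div_const w).add ((d.const_mul 2).div_const (w ^ 2))).add_const
      (2 / w ^ 3)).neg.mul ((d.const_mul w).neg.cexp)).comp_ofReal
    refine h.congr_deriv ?_
    simp [id]
    field_simp
    ring
  have hint : IntegrableOn (fun x : ℝ => (x : ℂ) ^ 2 * Complex.exp (-(w * x))) (Ioi 0) := by
    refine (integrableOn_pow_mul_exp_neg 2 hw).mono'
      (Continuous.aestronglyMeasurable (by fun_prop)) (Filter.Eventually.of_forall fun x => ?_)
    rw [norm_mul, hexp, norm_pow, Complex.norm_real, Real.norm_eq_abs, sq_abs]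
  have hT := ((((hlim 2).const_mul (1 / w)).add ((hlim 1).const_mul (2 / w ^ 2))).add
    ((hlim 0).const_mul (2 / w ^ 3))).neg
  have h := integral_Ioi_of_hasDerivAt_of_tendsto (m := 0)
    (hder 0).continuousAt.continuousWithinAt (fun x _ => hder x) hint
    (by simpa using hT.congr fun x => by ring)
  rw [h]
  simp

/-- Both sides are `∫ₓ x e^{-xz} / (x² + a²)`: write `1/(z²+t²)` as the Laplace transform of a
sine. -/
theorem integral_div_sq_add_sq_mul_exp {z : ℂ} (hz : 0 < z.re) {a : ℝ} (ha : 0 < a) :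
    ∫ t in Ioi (0 : ℝ), (t : ℂ) / (z ^ 2 + (t : ℂ) ^ 2) * (Real.exp (-(a * t)) : ℂ) =
      ∫ x in Ioi (0 : ℝ), Complex.exp (-z * x) * (x / ((a : ℂ) ^ 2 + (x : ℂ) ^ 2)) := by
  have hint : Integrable (Function.uncurry fun t x : ℝ =>
      Complex.exp (-z * x) * (Real.sin (t * x) : ℂ) * (Real.exp (-(a * t)) : ℂ))
      ((volume.restrict (Ioi 0)).prod (volume.restrict (Ioi 0))) := by
    have i1 : IntegrableOn (fun t : ℝ => Real.exp (-(a * t))) (Ioi 0) := by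
      simpa using integrableOn_pow_mul_exp_neg 0 ha
    have i2 : IntegrableOn (fun x : ℝ => Real.exp (-(z.re * x))) (Ioi 0) := by
      simpa using integrableOn_pow_mul_exp_neg 0 hz
    refine (Integrable.mul_prod i1 i2).mono' ?_ (Filter.Eventually.of_forall fun p => ?_)
    · exact Continuous.aestronglyMeasurable (by simp only [Function.uncurry_def]; fun_prop)
    · simp only [Function.uncurry_def, norm_mul, Complex.norm_real, Complex.norm_exp,
        Real.norm_eq_abs, Real.abs_exp]
      have h1 : (-z * (p.2 : ℂ)).re = -(z.re * p.2) := by simp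
      rw [h1, mul_comm (Real.exp (-(a * p.1)))]
      gcongr
      exact mul_le_of_le_one_right (Real.exp_pos _).le (Real.abs_sin_le_one _)
  have hswap := integral_integral_swap hint
  have e1 : ∀ t : ℝ, ∫ x in Ioi (0 : ℝ),
      Complex.exp (-z * x) * (Real.sin (t * x) : ℂ) * (Real.exp (-(a * t)) : ℂ) =
        (t : ℂ) / (z ^ 2 + (t : ℂ) ^ 2) * (Real.exp (-(a * t)) : ℂ) := by
    intro t
    rw [integral_mul_const, integral_exp_neg_mul_sin hz]
  have e2 : ∀ x : ℝ, ∫ t in Ioi (0 : ℝ),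
      Complex.exp (-z * x) * (Real.sin (t * x) : ℂ) * (Real.exp (-(a * t)) : ℂ) =
        Complex.exp (-z * x) * (x / ((a : ℂ) ^ 2 + (x : ℂ) ^ 2)) := by
    intro x
    have := integral_exp_neg_mul_sin (w := a) (by simpa using ha) x
    rw [← this, ← integral_const_mul]
    congr 1; ext t
    push_cast
    ring_nf
  simp only [e1, e2] at hswap
  exact hswap

theorem sq_mul_exp_neg_le {y : ℝ} (hy : 0 ≤ y) : y ^ 2 * Real.exp (-y) ≤ 2 := by
  have h := Real.quadratic_le_exp_of_nonneg hy
  have h2 : Real.exp y * Real.exp (-y) = 1 := by rw [← Real.exp_add]; simp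
  nlinarith [Real.exp_pos (-y)]

theorem integral_one_sub_cos_div_cube {z : ℂ} (hz : 0 < z.re) {a : ℝ} (ha : 0 < a) :
    ∫ t in Ioi (0 : ℝ), (1 - Real.cos (a * t) : ℝ) / ((t : ℂ) + z) ^ 3 =
      (a : ℂ) ^ 2 / 2 * ∫ t in Ioi (0 : ℝ), (t : ℂ) / (z ^ 2 + (t : ℂ) ^ 2)
        * (Real.exp (-(a * t)) : ℂ) := by
  rw [integral_div_sq_add_sq_mul_exp hz ha]
  set r := z.re
  have hr : 0 < r / 2 := by positivity
  -- on the quadrant, `x² e^{-x(t+r)}` is dominated by the product of `(t + r/2)⁻²` and `e^{-xr/2}`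
  have hint : Integrable (Function.uncurry fun t x : ℝ =>
      ((1 - Real.cos (a * t) : ℝ) : ℂ) * ((x : ℂ) ^ 2 * Complex.exp (-(((t : ℂ) + z) * x))))
      ((volume.restrict (Ioi 0)).prod (volume.restrict (Ioi 0))) := by
    have i1 : IntegrableOn (fun t : ℝ => 4 * (t + r / 2) ^ (-2 : ℝ)) (Ioi 0) :=
      (integrableOn_add_rpow_Ioi_of_lt (a := -2) (c := 0) (m := r / 2) (by norm_num)
        (by linarith)).const_mul 4
    have i2 : IntegrableOn (fun x : ℝ => Real.exp (-(r / 2 * x))) (Ioi 0) := by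
      simpa using integrableOn_pow_mul_exp_neg 0 hr
    refine (Integrable.mul_prod i1 i2).mono' ?_ ?_
    · exact Continuous.aestronglyMeasurable (by simp only [Function.uncurry_def]; fun_prop)
    · rw [Measure.prod_restrict]
      filter_upwards [ae_restrict_mem (measurableSet_Ioi.prod measurableSet_Ioi)] with p hp
      obtain ⟨t, x⟩ := p
      have ht : 0 < t := hp.1
      have hx : 0 < x := hp.2
      simp only [Function.uncurry_def, norm_mul, Complex.norm_real, Complex.norm_exp, norm_pow,
        Real.norm_eq_abs]
      have h1 : (-(((t : ℂ) + z) * (x : ℂ))).re = -((t + r) * x) := by simp [r]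
      have h2 : |1 - Real.cos (a * t)| ≤ 2 := by
        rw [abs_le]; constructor <;> linarith [Real.cos_le_one (a * t), Real.neg_one_le_cos (a * t)]
      have h3 := sq_mul_exp_neg_le (y := (t + r / 2) * x) (by positivity)
      have h4 : Real.exp (-((t + r) * x)) =
          Real.exp (-((t + r / 2) * x)) * Real.exp (-(r / 2 * x)) := by
        rw [← Real.exp_add]; ring_nf
      have h5 : (t + r / 2) ^ (-2 : ℝ) = ((t + r / 2) ^ 2)⁻¹ := by
        rw [Real.rpow_neg (by positivity)]; norm_cast
      have h6 : x ^ 2 * Real.exp (-((t + r / 2) * x)) ≤ 2 * ((t + r / 2) ^ 2)⁻¹ := by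
        rw [← div_eq_mul_inv, le_div_iff₀ (by positivity)]
        linarith
      rw [h1, h4, h5, abs_of_pos hx]
      calc _ = |1 - Real.cos (a * t)| * (x ^ 2 * Real.exp (-((t + r / 2) * x)))
            * Real.exp (-(r / 2 * x)) := by ring
        _ ≤ 2 * (2 * ((t + r / 2) ^ 2)⁻¹) * Real.exp (-(r / 2 * x)) := by gcongr
        _ = _ := by ring
  have hswap := integral_integral_swap hint
  have e1 : ∀ t ∈ Ioi (0 : ℝ), ∫ x in Ioi (0 : ℝ),
      ((1 - Real.cos (a * t) : ℝ) : ℂ) * ((x : ℂ) ^ 2 * Complex.exp (-(((t : ℂ) + z) * x))) =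
        2 * ((1 - Real.cos (a * t) : ℝ) / ((t : ℂ) + z) ^ 3) := by
    intro t ht
    have ht : 0 < t := ht
    rw [integral_const_mul, integral_sq_mul_exp_neg (by simp; positivity)]
    ring
  have e2 : ∀ x ∈ Ioi (0 : ℝ), ∫ t in Ioi (0 : ℝ),
      ((1 - Real.cos (a * t) : ℝ) : ℂ) * ((x : ℂ) ^ 2 * Complex.exp (-(((t : ℂ) + z) * x))) =
        (a : ℂ) ^ 2 * (Complex.exp (-z * x) * (x / ((a : ℂ) ^ 2 + (x : ℂ) ^ 2))) := by
    intro x hx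
    have hx : 0 < x := hx
    have h := integral_exp_neg_mul_one_sub_cos (w := x) (by simpa using hx) a
    have h' : ∀ t : ℝ, ((1 - Real.cos (a * t) : ℝ) : ℂ)
        * ((x : ℂ) ^ 2 * Complex.exp (-(((t : ℂ) + z) * x))) =
        (x : ℂ) ^ 2 * Complex.exp (-z * x) * (Complex.exp (-(x : ℂ) * t)
          * (1 - Real.cos (a * t) : ℝ)) := by
      intro t
      rw [show -(((t : ℂ) + z) * x) = -z * x + -(x : ℂ) * t by ring, Complex.exp_add]
      ring
    simp only [h']
    rw [integral_const_mul, h]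
    have hx0 : (x : ℂ) ≠ 0 := by exact_mod_cast hx.ne'
    rw [add_comm ((x : ℂ) ^ 2)]
    have : (a : ℂ) ^ 2 + (x : ℂ) ^ 2 ≠ 0 := sq_add_sq_ne_zero (by simpa using ha) x
    field_simp
  rw [setIntegral_congr_fun measurableSet_Ioi e1, setIntegral_congr_fun measurableSet_Ioi e2,
    integral_const_mul, integral_const_mul] at hswap
  linear_combination hswap / 2

/-! ### The dilogarithm integral -/

theorem ofReal_exp_pow_succ (t : ℝ) (n : ℕ) :
    (Real.exp (-2 * Real.pi * t) : ℂ) ^ (n + 1)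
      = (Real.exp (-(2 * Real.pi * (n + 1) * t)) : ℂ) := by
  rw [← Complex.ofReal_pow, ← Real.exp_nat_mul]
  congr 2
  push_cast
  ring

theorem dilog_exp (t : ℝ) : dilog (Real.exp (-2 * Real.pi * t) : ℂ) =
    ∑' n : ℕ, (Real.exp (-(2 * Real.pi * (n + 1) * t)) : ℂ) / ((n : ℂ) + 1) ^ 2 := by
  simp only [dilog, ofReal_exp_pow_succ]

theorem norm_natCast_add_one (n : ℕ) : ‖(n : ℂ) + 1‖ = n + 1 := by
  rw [show (n : ℂ) + 1 = ((n + 1 : ℝ) : ℂ) by push_cast; rfl, Complex.norm_real,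
    Real.norm_of_nonneg (by positivity)]

theorem exp_neg_succ_mul_le {t : ℝ} (ht : 0 ≤ t) (n : ℕ) :
    Real.exp (-(2 * Real.pi * (n + 1) * t)) ≤ Real.exp (-(2 * Real.pi * t)) := by
  refine Real.exp_le_exp.2 (neg_le_neg ?_)
  have : 0 ≤ 2 * Real.pi * t * n := by positivity
  linarith

theorem norm_dilog_exp_term_le {t : ℝ} (ht : 0 ≤ t) (n : ℕ) :
    ‖(Real.exp (-(2 * Real.pi * (n + 1) * t)) : ℂ) / ((n : ℂ) + 1) ^ 2‖ ≤
      Real.exp (-(2 * Real.pi * t)) * (1 / ((n : ℝ) + 1) ^ 2) := by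
  rw [norm_div, norm_pow, norm_natCast_add_one, Complex.norm_real, Real.norm_eq_abs, Real.abs_exp,
    mul_one_div]
  have := exp_neg_succ_mul_le ht n
  gcongr

theorem summable_dilog_exp_term {t : ℝ} (ht : 0 ≤ t) :
    Summable fun n : ℕ =>
      (Real.exp (-(2 * Real.pi * (n + 1) * t)) : ℂ) / ((n : ℂ) + 1) ^ 2 :=
  Summable.of_norm_bounded (summable_const_mul_one_div_succ_sq _) (norm_dilog_exp_term_le ht)

theorem continuousOn_dilog_exp :
    ContinuousOn (fun t : ℝ => dilog (Real.exp (-2 * Real.pi * t) : ℂ)) (Ici 0) := by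
  simp only [dilog_exp]
  refine continuousOn_tsum (u := fun n : ℕ => 1 * (1 / ((n : ℝ) + 1) ^ 2))
    (fun n => Continuous.continuousOn (by fun_prop)) (summable_const_mul_one_div_succ_sq 1)
    fun n t ht => (norm_dilog_exp_term_le ht n).trans ?_
  gcongr
  refine Real.exp_le_one_iff.2 (neg_nonpos.2 ?_)
  have : (0 : ℝ) ≤ t := ht
  positivity

theorem exists_norm_dilog_exp_le : ∃ C : ℝ, 0 ≤ C ∧ ∀ t : ℝ, 0 ≤ t →
    ‖dilog (Real.exp (-2 * Real.pi * t) : ℂ)‖ ≤ C * Real.exp (-(2 * Real.pi * t)) := by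
  have hs := summable_const_mul_one_div_succ_sq 1
  simp only [one_mul] at hs
  refine ⟨∑' n : ℕ, 1 / ((n : ℝ) + 1) ^ 2, tsum_nonneg fun n => by positivity, fun t ht => ?_⟩
  rw [dilog_exp, mul_comm (∑' n : ℕ, _)]
  exact tsum_of_norm_bounded (hs.hasSum.mul_left _) (norm_dilog_exp_term_le ht)

theorem integrableOn_mul_dilog_exp {φ : ℝ → ℂ}
    (hm : AEStronglyMeasurable φ (volume.restrict (Ioi 0)))
    (hφ : IntegrableOn (fun t => φ t * (Real.exp (-(2 * Real.pi * t)) : ℂ)) (Ioi 0)) :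
    IntegrableOn (fun t => φ t * dilog (Real.exp (-2 * Real.pi * t) : ℂ)) (Ioi 0) := by
  obtain ⟨C, -, hC⟩ := exists_norm_dilog_exp_le
  refine (hφ.norm.const_mul C).mono' (hm.mul
    ((continuousOn_dilog_exp.mono Ioi_subset_Ici_self).aestronglyMeasurable measurableSet_Ioi)) ?_
  filter_upwards [ae_restrict_mem measurableSet_Ioi] with t ht
  rw [norm_mul, norm_mul, mul_left_comm, Complex.norm_real, Real.norm_eq_abs, Real.abs_exp]
  gcongr
  exact hC t (le_of_lt ht)

/-- Termwise integration of the series of `Li₂(e^{-2πt})`. -/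
theorem hasSum_integral_mul_dilog_exp {φ : ℝ → ℂ}
    (hm : AEStronglyMeasurable φ (volume.restrict (Ioi 0)))
    (hφ : IntegrableOn (fun t => φ t * (Real.exp (-(2 * Real.pi * t)) : ℂ)) (Ioi 0)) :
    HasSum (fun n : ℕ => 1 / ((n : ℂ) + 1) ^ 2
        * ∫ t in Ioi (0 : ℝ), φ t * (Real.exp (-(2 * Real.pi * (n + 1) * t)) : ℂ))
      (∫ t in Ioi (0 : ℝ), φ t * dilog (Real.exp (-2 * Real.pi * t) : ℂ)) := by
  have hs := summable_const_mul_one_div_succ_sq 1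
  simp only [one_mul] at hs
  have h := hasSum_integral_of_dominated_convergence (μ := volume.restrict (Ioi (0 : ℝ)))
    (F := fun (n : ℕ) t => φ t * ((Real.exp (-(2 * Real.pi * (n + 1) * t)) : ℂ)
      / ((n : ℂ) + 1) ^ 2))
    (f := fun t => φ t * dilog (Real.exp (-2 * Real.pi * t) : ℂ))
    (fun n t => 1 / ((n : ℝ) + 1) ^ 2 * ‖φ t * (Real.exp (-(2 * Real.pi * t)) : ℂ)‖)
    (fun n => hm.mul (Continuous.aestronglyMeasurable (by fun_prop))) ?_ ?_ ?_ ?_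
  · refine h.congr_fun fun n => ?_
    rw [← integral_const_mul]
    congr 1; ext t
    ring
  · intro n
    filter_upwards [ae_restrict_mem measurableSet_Ioi] with t ht
    have := norm_dilog_exp_term_le (le_of_lt ht) n
    rw [norm_mul, norm_mul, Complex.norm_real (Real.exp _), Real.norm_eq_abs, Real.abs_exp,
      mul_left_comm, mul_comm (1 / _)]
    gcongr
  · exact Filter.Eventually.of_forall fun t => hs.mul_right _
  · simp only [tsum_mul_right]
    exact hφ.norm.const_mul _
  · filter_upwards [ae_restrict_mem measurableSet_Ioi] with t ht
    rw [dilog_exp]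
    exact (summable_dilog_exp_term (le_of_lt ht)).hasSum.mul_left _

theorem re_sq_le_norm_sq_add_sq {z : ℂ} (hz : 0 < z.re) (t : ℝ) :
    z.re ^ 2 ≤ ‖z ^ 2 + (t : ℂ) ^ 2‖ := by
  have h : z ^ 2 + (t : ℂ) ^ 2 = (z - t * I) * (z + t * I) := by
    linear_combination (t : ℂ) ^ 2 * I_sq
  rw [h, norm_mul, sq]
  have h1 : z.re ≤ ‖z - t * I‖ := (le_of_eq (by simp)).trans (re_le_norm _)
  have h2 : z.re ≤ ‖z + t * I‖ := (le_of_eq (by simp)).trans (re_le_norm _)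
  gcongr

theorem one_add_div_sq_eq {z : ℂ} (hz : 0 < z.re) (t : ℝ) :
    1 + ((t : ℂ) / z) ^ 2 = (z ^ 2 + (t : ℂ) ^ 2) / z ^ 2 := by
  have hz0 : z ≠ 0 := by rintro rfl; simp at hz
  field_simp

theorem one_add_div_sq_ne_zero {z : ℂ} (hz : 0 < z.re) (t : ℝ) :
    1 + ((t : ℂ) / z) ^ 2 ≠ 0 := by
  have hz0 : z ≠ 0 := by rintro rfl; simp at hz
  rw [one_add_div_sq_eq hz]
  exact div_ne_zero (sq_add_sq_ne_zero hz t) (pow_ne_zero 2 hz0)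

theorem continuous_pow_div_one_add_sq {z : ℂ} (hz : 0 < z.re) (m : ℕ) :
    Continuous fun t : ℝ => (t : ℂ) ^ m / (1 + ((t : ℂ) / z) ^ 2) :=
  Continuous.div (by fun_prop) (by fun_prop) (one_add_div_sq_ne_zero hz)

theorem norm_pow_div_one_add_sq_le {z : ℂ} (hz : 0 < z.re) (m : ℕ) {t : ℝ} (ht : 0 ≤ t) :
    ‖(t : ℂ) ^ m / (1 + ((t : ℂ) / z) ^ 2)‖ ≤ ‖z‖ ^ 2 / z.re ^ 2 * t ^ m := by
  rw [one_add_div_sq_eq hz, norm_div, norm_div, norm_pow, norm_pow z, Complex.norm_real,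
    Real.norm_of_nonneg ht]
  have := re_sq_le_norm_sq_add_sq hz t
  rw [div_div_eq_mul_div, div_mul_eq_mul_div, mul_comm]
  gcongr

theorem integrableOn_pow_mul_exp_ofReal (m : ℕ) {b : ℝ} (hb : 0 < b) :
    IntegrableOn (fun t : ℝ => (t : ℂ) ^ m * (Real.exp (-(b * t)) : ℂ)) (Ioi 0) := by
  have h : IntegrableOn (fun t : ℝ => ((t ^ m * Real.exp (-(b * t)) : ℝ) : ℂ)) (Ioi 0) :=
    (integrableOn_pow_mul_exp_neg m hb).ofReal
  simpa only [Complex.ofReal_mul, Complex.ofReal_pow] using h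

theorem integrableOn_pow_div_mul_exp {z : ℂ} (hz : 0 < z.re) (m : ℕ) {b : ℝ} (hb : 0 < b) :
    IntegrableOn (fun t : ℝ => (t : ℂ) ^ m / (1 + ((t : ℂ) / z) ^ 2)
      * (Real.exp (-(b * t)) : ℂ)) (Ioi 0) := by
  refine ((integrableOn_pow_mul_exp_neg m hb).const_mul (‖z‖ ^ 2 / z.re ^ 2)).mono'
    (Continuous.aestronglyMeasurable ((continuous_pow_div_one_add_sq hz m).mul (by fun_prop))) ?_
  filter_upwards [ae_restrict_mem measurableSet_Ioi] with t ht
  rw [norm_mul, Complex.norm_real (Real.exp _), Real.norm_eq_abs, Real.abs_exp, ← mul_assoc]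
  gcongr
  exact norm_pow_div_one_add_sq_le hz m (le_of_lt ht)

theorem integrableOn_pow_div_mul_dilog {z : ℂ} (hz : 0 < z.re) (m : ℕ) :
    IntegrableOn (fun t : ℝ => (t : ℂ) ^ m / (1 + ((t : ℂ) / z) ^ 2)
      * dilog (Real.exp (-2 * Real.pi * t) : ℂ)) (Ioi 0) :=
  integrableOn_mul_dilog_exp (continuous_pow_div_one_add_sq hz m).aestronglyMeasurable
    (integrableOn_pow_div_mul_exp hz m (by positivity))

theorem integral_pow_mul_exp_ofReal (m : ℕ) {b : ℝ} (hb : 0 < b) :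
    ∫ t in Ioi (0 : ℝ), (t : ℂ) ^ m * (Real.exp (-(b * t)) : ℂ) =
      (m.factorial : ℂ) / (b : ℂ) ^ (m + 1) := by
  have h := Real.integral_rpow_mul_exp_neg_mul_Ioi (a := m + 1) (r := b) (by positivity) hb
  rw [Real.Gamma_nat_eq_factorial, add_sub_cancel_right] at h
  have h' : ∫ t in Ioi (0 : ℝ), t ^ m * Real.exp (-(b * t)) = m.factorial / b ^ (m + 1) := by
    have e : (1 / b) ^ ((m : ℝ) + 1) = (1 / b) ^ (m + 1) := by
      rw [← Real.rpow_natCast]; push_cast; rfl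
    rw [e] at h
    simp only [Real.rpow_natCast] at h
    rw [h, one_div, inv_pow]
    field_simp
  have h2 : ∫ t in Ioi (0 : ℝ), (t : ℂ) ^ m * (Real.exp (-(b * t)) : ℂ) =
      ((∫ t in Ioi (0 : ℝ), t ^ m * Real.exp (-(b * t)) : ℝ) : ℂ) := by
    rw [← integral_complex_ofReal]
    congr 1; ext t
    push_cast
    rfl
  rw [h2, h']
  push_cast
  rfl

/-- The moments of `Li₂(e^{-2πt})` are values of `ζ` at even integers. -/
theorem integral_pow_mul_dilog {N : ℕ} (hN : 1 ≤ N) :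
    ∫ t in Ioi (0 : ℝ), (t : ℂ) ^ (2 * N - 1) * dilog (Real.exp (-2 * Real.pi * t) : ℂ) =
      (-1) ^ N * 2 * (Real.pi : ℂ) ^ 2 * bernoulli (2 * N + 2)
        / (2 * N * (2 * N + 1) * (2 * N + 2)) := by
  have h1 := hasSum_integral_mul_dilog_exp (φ := fun t : ℝ => (t : ℂ) ^ (2 * N - 1))
    (Continuous.aestronglyMeasurable (by fun_prop))
    (integrableOn_pow_mul_exp_ofReal (2 * N - 1) (by positivity))
  have hz := hasSum_zeta_nat (k := N + 1) (by omega)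
  have hz' := (hasSum_nat_add_iff' 1).2 hz
  have hz2 := (Complex.hasSum_ofReal.2 hz').mul_left
    (((2 * N - 1).factorial : ℂ) / (2 * Real.pi : ℂ) ^ (2 * N))
  have hpi : (Real.pi : ℂ) ≠ 0 := by exact_mod_cast Real.pi_ne_zero
  have hval : (-1) ^ N * 2 * (Real.pi : ℂ) ^ 2 * bernoulli (2 * N + 2)
      / (2 * N * (2 * N + 1) * (2 * N + 2)) =
      ((2 * N - 1).factorial : ℂ) / (2 * Real.pi : ℂ) ^ (2 * N)
        * (((-1) ^ (N + 1 + 1) * 2 ^ (2 * (N + 1) - 1) * Real.pi ^ (2 * (N + 1))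
            * (bernoulli (2 * (N + 1)) : ℝ) / (2 * (N + 1)).factorial
          - ∑ i ∈ Finset.range 1, 1 / (i : ℝ) ^ (2 * (N + 1)) : ℝ) : ℂ) := by
    obtain ⟨M, rfl⟩ : ∃ M, N = M + 1 := ⟨N - 1, by omega⟩
    rw [show 2 * (M + 1) - 1 = 2 * M + 1 by omega, show 2 * (M + 1 + 1) - 1 = 2 * M + 3 by omega,
      show 2 * (M + 1 + 1) = 2 * M + 1 + 1 + 1 + 1 by ring,
      show 2 * (M + 1) + 2 = 2 * M + 1 + 1 + 1 + 1 by ring,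
      show 2 * (M + 1) = 2 * M + 2 by ring]
    have hf : ((2 * M + 1 : ℕ).factorial : ℂ) ≠ 0 := by
      exact_mod_cast (Nat.factorial_pos _).ne'
    have e1 : (2 * (M : ℂ) + 1 + 1) ≠ 0 := by exact_mod_cast (by omega : 2 * M + 1 + 1 ≠ 0)
    have e2 : (2 * (M : ℂ) + 1 + 1 + 1) ≠ 0 := by
      exact_mod_cast (by omega : 2 * M + 1 + 1 + 1 ≠ 0)
    have e3 : (2 * (M : ℂ) + 1 + 1 + 1 + 1) ≠ 0 := by
      exact_mod_cast (by omega : 2 * M + 1 + 1 + 1 + 1 ≠ 0)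
    rw [Nat.factorial_succ (2 * M + 1 + 1 + 1), Nat.factorial_succ (2 * M + 1 + 1),
      Nat.factorial_succ (2 * M + 1)]
    simp only [Finset.range_one, Finset.sum_singleton, Nat.cast_zero]
    rw [zero_pow (by omega), div_zero, sub_zero]
    push_cast
    rw [show 2 * ((M : ℂ) + 1) + 2 = 2 * M + 1 + 1 + 1 + 1 by ring,
      show 2 * ((M : ℂ) + 1) + 1 = 2 * M + 1 + 1 + 1 by ring,
      show 2 * ((M : ℂ) + 1) = 2 * M + 1 + 1 by ring, mul_pow]
    rw [show (2 : ℂ) ^ (2 * M + 3) = 2 ^ (2 * M + 2) * 2 by rw [← pow_succ],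
      show (Real.pi : ℂ) ^ (2 * M + 1 + 1 + 1 + 1) = Real.pi ^ (2 * M + 2) * Real.pi ^ 2 by
        rw [← pow_add]]
    field_simp
    ring
  refine h1.unique ?_
  rw [hval]
  refine hz2.congr_fun fun n => ?_
  have hn : (n : ℂ) + 1 ≠ 0 := by exact_mod_cast n.succ_ne_zero
  have := integral_pow_mul_exp_ofReal (2 * N - 1) (b := 2 * Real.pi * (n + 1)) (by positivity)
  rw [this, show 2 * N - 1 + 1 = 2 * N by omega, show 2 * (N + 1) = 2 * N + 2 by ring]
  push_cast
  rw [pow_add, mul_pow _ ((n : ℂ) + 1)]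
  field_simp

/-- The Fourier series of `B₄({t}) - B₄`. -/
theorem hasSum_one_sub_cos (t : ℝ) :
    HasSum (fun n : ℕ => 3 / (Real.pi : ℂ) ^ 4 * ((1 - Real.cos (2 * Real.pi * (n + 1) * t) : ℝ)
      / ((n : ℂ) + 1) ^ 4)) (-(bernoulli 4 : ℂ) + (bernoulliFun 4 (Int.fract t) : ℂ)) := by
  have h1 := hasSum_one_div_nat_pow_mul_cos two_ne_zero
    (x := Int.fract t) ⟨Int.fract_nonneg t, (Int.fract_lt_one t).le⟩
  have h0 := hasSum_one_div_nat_pow_mul_cos two_ne_zero (x := 0) ⟨le_rfl, zero_le_one⟩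
  have h := ((hasSum_nat_add_iff' 1).2 (h0.sub h1)).mul_left (3 / Real.pi ^ 4)
  have h' := Complex.hasSum_ofReal.2 h
  have hval : (-(bernoulli 4 : ℂ) + (bernoulliFun 4 (Int.fract t) : ℂ)) =
      ((3 / Real.pi ^ 4 * (Real.pi ^ 4 / 3 * (bernoulliFun 4 (Int.fract t) - bernoulliFun 4 0))
        : ℝ) : ℂ) := by
    have e0 := bernoulliFun_eval_zero 4
    have hpi : (Real.pi : ℂ) ≠ 0 := by exact_mod_cast Real.pi_ne_zero
    rw [e0]
    push_cast
    field_simp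
    ring
  rw [hval]
  convert h'.congr_fun (fun n => ?_) using 4
  · unfold bernoulliFun
    norm_num [Nat.factorial]
    ring
  · have hcos : Real.cos (2 * Real.pi * (n + 1) * Int.fract t)
        = Real.cos (2 * Real.pi * (n + 1) * t) := by
      have := Real.cos_sub_int_mul_two_pi (2 * Real.pi * (n + 1) * t) (((n + 1 : ℕ) : ℤ) * ⌊t⌋)
      rw [← this]
      congr 1
      rw [Int.fract]
      push_cast
      ring
    rw [← hcos]
    push_cast
    simp
    ring

theorem re_pos_slitPlane {z : ℂ} (hz : 0 < z.re) : z ∈ slitPlane := Or.inl hz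

/-- Termwise integration of the Fourier series of `B₄({t}) - B₄`. -/
theorem integral_bernoulliFun_four_sub {z : ℂ} (hz : 0 < z.re) :
    ∫ t in Ioi (0 : ℝ), (-(bernoulli 4 : ℂ) + (bernoulliFun 4 (Int.fract t) : ℂ))
        / ((t : ℂ) + z) ^ 3 =
      6 / (Real.pi : ℂ) ^ 2 / z ^ 2 * ∫ t in Ioi (0 : ℝ), (t : ℂ) ^ 1 / (1 + ((t : ℂ) / z) ^ 2)
        * dilog (Real.exp (-2 * Real.pi * t) : ℂ) := by
  have hz0 : z ≠ 0 := by rintro rfl; simp at hz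
  have hpi : (Real.pi : ℂ) ≠ 0 := by exact_mod_cast Real.pi_ne_zero
  have hinv := integrableOn_add_pow_inv (re_pos_slitPlane hz) (m := 3) (by norm_num)
  have hs : Summable fun n : ℕ => ‖3 / (Real.pi : ℂ) ^ 4‖ * (2 * (1 / ((n : ℝ) + 1) ^ 4)) := by
    have := (summable_nat_add_iff 1).2 (Real.summable_one_div_nat_pow.2 (by norm_num : 1 < 4))
    push_cast at this
    exact (this.mul_left 2).mul_left _
  have hB := (hasSum_integral_mul_dilog_exp
    (continuous_pow_div_one_add_sq hz 1).aestronglyMeasurable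
    (integrableOn_pow_div_mul_exp hz 1 (by positivity))).mul_left (6 / (Real.pi : ℂ) ^ 2 / z ^ 2)
  have hA := hasSum_integral_of_dominated_convergence (μ := volume.restrict (Ioi (0 : ℝ)))
    (F := fun (n : ℕ) (t : ℝ) => 3 / (Real.pi : ℂ) ^ 4
      * ((1 - Real.cos (2 * Real.pi * (n + 1) * t) : ℝ) / ((n : ℂ) + 1) ^ 4)
      * (((t : ℂ) + z) ^ 3)⁻¹)
    (f := fun t : ℝ => (-(bernoulli 4 : ℂ) + (bernoulliFun 4 (Int.fract t) : ℂ))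
      * (((t : ℂ) + z) ^ 3)⁻¹)
    (fun n t => ‖3 / (Real.pi : ℂ) ^ 4‖ * (2 * (1 / ((n : ℝ) + 1) ^ 4))
      * ‖(((t : ℂ) + z) ^ 3)⁻¹‖)
    (fun n => (Continuous.aestronglyMeasurable (by fun_prop)).mul hinv.aestronglyMeasurable)
    ?_ ?_ ?_ ?_
  · refine (hA.congr_fun fun n => ?_).unique hB
    have hn : (n : ℂ) + 1 ≠ 0 := by exact_mod_cast n.succ_ne_zero
    have h := integral_one_sub_cos_div_cube hz (a := 2 * Real.pi * (n + 1)) (by positivity)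
    have e1 : ∀ t : ℝ, 3 / (Real.pi : ℂ) ^ 4
        * ((1 - Real.cos (2 * Real.pi * (n + 1) * t) : ℝ) / ((n : ℂ) + 1) ^ 4)
        * (((t : ℂ) + z) ^ 3)⁻¹ = 3 / (Real.pi : ℂ) ^ 4 / ((n : ℂ) + 1) ^ 4
          * ((1 - Real.cos (2 * Real.pi * (n + 1) * t) : ℝ) / ((t : ℂ) + z) ^ 3) := fun t => by
      ring
    have e2 : ∀ t : ℝ, (t : ℂ) / (z ^ 2 + (t : ℂ) ^ 2)
        * (Real.exp (-(2 * Real.pi * (n + 1) * t)) : ℂ) = (z ^ 2)⁻¹ *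
          ((t : ℂ) ^ 1 / (1 + ((t : ℂ) / z) ^ 2)
            * (Real.exp (-(2 * Real.pi * (n + 1) * t)) : ℂ)) := fun t => by
      rw [one_add_div_sq_eq hz]
      have := sq_add_sq_ne_zero hz t
      field_simp
    simp only [e1, e2] at h ⊢
    rw [integral_const_mul, h, integral_const_mul]
    generalize ∫ t in Ioi (0 : ℝ), (t : ℂ) ^ 1 / (1 + ((t : ℂ) / z) ^ 2)
      * (Real.exp (-(2 * Real.pi * (n + 1) * t)) : ℂ) = J
    push_cast
    field_simp
    ring
  · intro n
    refine Filter.Eventually.of_forall fun t => ?_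
    rw [norm_mul, norm_mul, norm_div (_ : ℂ) (((n : ℂ) + 1) ^ 4), norm_pow, norm_natCast_add_one,
      Complex.norm_real, Real.norm_eq_abs, mul_one_div]
    have h2 : |1 - Real.cos (2 * Real.pi * (n + 1) * t)| ≤ 2 := by
      have h3 := Real.cos_le_one (2 * Real.pi * (n + 1) * t)
      have h4 := Real.neg_one_le_cos (2 * Real.pi * (n + 1) * t)
      rw [abs_le]; constructor <;> linarith
    gcongr
  · exact Filter.Eventually.of_forall fun t => hs.mul_right _
  · simp only [tsum_mul_right]
    exact hinv.norm.const_mul _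
  · exact Filter.Eventually.of_forall fun t => (hasSum_one_sub_cos t).mul_right _

/-- Induction on `N`: since `t²/z² = (1 + t²/z²) - 1`, raising `N` splits off a moment of the
dilogarithm, which is the next term of the expansion. -/
theorem barnesRemainder_eq_integral_dilog {N : ℕ} (hN : 1 ≤ N) {z : ℂ} (hz : 0 < z.re) :
    barnesRemainder N z = 1 / z ^ (2 * N) * ((-1) ^ N / (2 * (Real.pi : ℂ) ^ 2))
      * ∫ t in Ioi (0 : ℝ), (t : ℂ) ^ (2 * N - 1) / (1 + ((t : ℂ) / z) ^ 2)
        * dilog (Real.exp (-2 * Real.pi * t) : ℂ) := by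
  have hz0 : z ≠ 0 := by rintro rfl; simp at hz
  have hpi : (Real.pi : ℂ) ≠ 0 := by exact_mod_cast Real.pi_ne_zero
  induction N, hN using Nat.le_induction with
  | base =>
    have h := barnesRemainder_eq_integral_even le_rfl (re_pos_slitPlane hz)
    norm_num only [mul_one, Nat.cast_one] at h ⊢
    rw [h, integral_bernoulliFun_four_sub hz]
    generalize ∫ t in Ioi (0 : ℝ), (t : ℂ) ^ 1 / (1 + ((t : ℂ) / z) ^ 2)
        * dilog (Real.exp (-2 * Real.pi * t) : ℂ) = J
    field_simp
    ring
  | succ N hN ih =>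
    have hsplit : ∀ t : ℝ, (t : ℂ) ^ (2 * (N + 1) - 1) / (1 + ((t : ℂ) / z) ^ 2)
        * dilog (Real.exp (-2 * Real.pi * t) : ℂ) =
        z ^ 2 * ((t : ℂ) ^ (2 * N - 1) * dilog (Real.exp (-2 * Real.pi * t) : ℂ)
          - (t : ℂ) ^ (2 * N - 1) / (1 + ((t : ℂ) / z) ^ 2)
            * dilog (Real.exp (-2 * Real.pi * t) : ℂ)) := by
      intro t
      have := one_add_div_sq_ne_zero hz t
      rw [show 2 * (N + 1) - 1 = (2 * N - 1) + 2 by omega, pow_add]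
      have h2 : (t : ℂ) ^ 2 = z ^ 2 * ((t : ℂ) / z) ^ 2 := by field_simp
      rw [h2]
      generalize ((t : ℂ) / z) ^ 2 = q at this ⊢
      field_simp
      ring
    have hi := integrableOn_mul_dilog_exp (φ := fun t : ℝ => (t : ℂ) ^ (2 * N - 1))
      (Continuous.aestronglyMeasurable (by fun_prop))
      (integrableOn_pow_mul_exp_ofReal (2 * N - 1) (by positivity))
    simp only [hsplit]
    rw [integral_const_mul, integral_sub hi (integrableOn_pow_div_mul_dilog hz _),
      integral_pow_mul_dilog hN, barnesRemainder_succ hN, ih]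
    have hN0 : (N : ℂ) ≠ 0 := by exact_mod_cast (by omega : N ≠ 0)
    have h1 : (2 * (N : ℂ) + 1) ≠ 0 := by exact_mod_cast (by omega : 2 * N + 1 ≠ 0)
    have h6 : (2 * (N : ℂ) + 2) ≠ 0 := by exact_mod_cast (by omega : 2 * N + 2 ≠ 0)
    have h7 : ((-1 : ℂ) ^ N) ^ 2 = 1 := by rw [← pow_mul, mul_comm, pow_mul]; simp
    generalize ∫ t in Ioi (0 : ℝ), (t : ℂ) ^ (2 * N - 1) / (1 + ((t : ℂ) / z) ^ 2)
        * dilog (Real.exp (-2 * Real.pi * t) : ℂ) = J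
    rw [show 2 * (N + 1) = 2 * N + 2 by ring, pow_add z, pow_succ (-1 : ℂ) N]
    field_simp
    linear_combination ((Real.pi : ℂ) ^ 2 * (bernoulli (2 * N + 2) : ℂ)) * h7

/-! ### The logarithmic integral -/

theorem hasDerivAt_dilog_exp {t : ℝ} (ht : 0 < t) :
    HasDerivAt (fun t : ℝ => dilog (Real.exp (-2 * Real.pi * t) : ℂ))
      (2 * Real.pi * (Real.log (1 - Real.exp (-2 * Real.pi * t)) : ℂ)) t := by
  have hpi := Real.pi_pos
  simp only [dilog_exp]
  have hq : Real.exp (-2 * Real.pi * t) < 1 := Real.exp_lt_one_iff.2 (by nlinarith)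
  have hq' : Real.exp (-2 * Real.pi * (t / 2)) < 1 := Real.exp_lt_one_iff.2 (by nlinarith)
  have hpow : ∀ (s : ℝ) (n : ℕ), Real.exp (-(2 * Real.pi * (n + 1) * s)) =
      Real.exp (-2 * Real.pi * s) ^ (n + 1) := fun s n => by
    rw [← Real.exp_nat_mul]; congr 1; push_cast; ring
  have hd := hasDerivAt_tsum_of_isPreconnected
    (g := fun (n : ℕ) (t : ℝ) =>
      (Real.exp (-(2 * Real.pi * (n + 1) * t)) : ℂ) / ((n : ℂ) + 1) ^ 2)
    (g' := fun (n : ℕ) (t : ℝ) =>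
      -2 * Real.pi * ((Real.exp (-(2 * Real.pi * (n + 1) * t)) : ℂ) / ((n : ℂ) + 1)))
    (u := fun n : ℕ => 2 * Real.pi * Real.exp (-2 * Real.pi * (t / 2)) ^ (n + 1))
    (t := Ioi (t / 2)) (y₀ := t) (y := t) ?_ isOpen_Ioi isPreconnected_Ioi ?_ ?_
    (mem_Ioi.2 (by linarith)) (summable_dilog_exp_term ht.le) (mem_Ioi.2 (by linarith))
  · refine hd.congr_deriv ?_
    have hlog := Real.hasSum_pow_div_log_of_abs_lt_one (x := Real.exp (-2 * Real.pi * t))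
      (by rwa [Real.abs_exp])
    have hlog' := (Complex.hasSum_ofReal.2 hlog).mul_left (-2 * Real.pi : ℂ)
    have h3 : HasSum (fun n : ℕ => -2 * (Real.pi : ℂ)
        * ((Real.exp (-(2 * Real.pi * (n + 1) * t)) : ℂ) / ((n : ℂ) + 1)))
        (-2 * Real.pi * ((-Real.log (1 - Real.exp (-2 * Real.pi * t)) : ℝ) : ℂ)) := by
      refine hlog'.congr_fun fun n => ?_
      rw [hpow]
      push_cast
      rfl
    rw [h3.tsum_eq]
    push_cast
    ring
  · exact ((summable_nat_add_iff 1).2 (summable_geometric_of_lt_one (Real.exp_pos _).le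
      hq')).mul_left _
  · intro n y _
    have hn : (n : ℂ) + 1 ≠ 0 := by exact_mod_cast n.succ_ne_zero
    have h := ((((hasDerivAt_id y).const_mul
      (2 * Real.pi * (n + 1))).neg.exp).ofReal_comp).div_const (((n : ℂ) + 1) ^ 2)
    refine h.congr_deriv ?_
    simp only [id, Pi.neg_apply]
    push_cast
    field_simp
  · intro n y hy
    have hy : t / 2 < y := hy
    have hn1 : (1 : ℝ) ≤ n + 1 := by linarith [(Nat.cast_nonneg n : (0 : ℝ) ≤ n)]
    rw [norm_mul, norm_div, norm_natCast_add_one, Complex.norm_real (Real.exp _),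
      Real.norm_eq_abs, Real.abs_exp, hpow]
    have h1 : ‖(-2 * (Real.pi : ℂ))‖ = 2 * Real.pi := by simp [abs_of_pos hpi]
    rw [h1]
    have h2 : Real.exp (-2 * Real.pi * y) ^ (n + 1) / (n + 1) ≤
        Real.exp (-2 * Real.pi * y) ^ (n + 1) := div_le_self (by positivity) hn1
    have h3 : Real.exp (-2 * Real.pi * y) ≤ Real.exp (-2 * Real.pi * (t / 2)) :=
      Real.exp_le_exp.2 (by nlinarith)
    calc _ ≤ 2 * Real.pi * Real.exp (-2 * Real.pi * y) ^ (n + 1) := by gcongr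
      _ ≤ _ := by gcongr

theorem abs_log_one_sub_exp_le {t : ℝ} (ht : 0 < t) :
    |Real.log (1 - Real.exp (-2 * Real.pi * t))| ≤
      Real.exp (-(Real.pi * t)) / (2 * Real.pi * t) := by
  have hpi := Real.pi_pos
  set y := Real.pi * t with hy
  have hy0 : 0 < y := by positivity
  have hq : Real.exp (-2 * Real.pi * t) = Real.exp (-y) * Real.exp (-y) := by
    rw [← Real.exp_add]; congr 1; rw [hy]; ring
  have he : Real.exp y * Real.exp (-y) = 1 := by rw [← Real.exp_add]; simp
  have hlt : Real.exp (-y) < 1 := Real.exp_lt_one_iff.2 (by linarith)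
  have hE := Real.exp_pos (-y)
  have hpos : 0 < 1 - Real.exp (-y) * Real.exp (-y) := by nlinarith
  rw [hq, abs_of_nonpos (Real.log_nonpos hpos.le (by nlinarith))]
  have h1 := Real.one_sub_inv_le_log_of_pos hpos
  -- `sinh y ≥ y` in the form `e^{-y} (e^y - e^{-y}) ≥ 2 y e^{-y}`
  have h2 : 2 * y * Real.exp (-y) ≤ 1 - Real.exp (-y) * Real.exp (-y) := by
    have h3 := Real.self_le_sinh_iff.2 hy0.le
    rw [Real.sinh_eq] at h3
    nlinarith
  have h4 : (1 - Real.exp (-y) * Real.exp (-y))⁻¹ - 1 =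
      Real.exp (-y) * Real.exp (-y) / (1 - Real.exp (-y) * Real.exp (-y)) := by
    rw [eq_div_iff hpos.ne', sub_mul, inv_mul_cancel₀ hpos.ne']
    ring
  calc _ ≤ (1 - Real.exp (-y) * Real.exp (-y))⁻¹ - 1 := by linarith
    _ ≤ Real.exp (-y) * Real.exp (-y) / (2 * y * Real.exp (-y)) := by rw [h4]; gcongr
    _ = _ := by rw [hy]; field_simp

/-- The inner integral of the logarithmic formula, rescaled to a primitive. -/
theorem integral_zero_one_mul_pow {z : ℂ} (N : ℕ) (hN : 1 ≤ N) {t : ℝ} (ht : 0 < t) :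
    (∫ s in (0 : ℝ)..1, (s : ℂ) ^ (2 * N - 1) / (1 + ((s : ℂ) * (t : ℂ) / z) ^ 2))
        * (t : ℂ) ^ (2 * N) =
      ∫ x in (0 : ℝ)..t, (x : ℂ) ^ (2 * N - 1) / (1 + ((x : ℂ) / z) ^ 2) := by
  have h := intervalIntegral.integral_comp_mul_right (a := 0) (b := 1)
    (fun x : ℝ => (x : ℂ) ^ (2 * N - 1) / (1 + ((x : ℂ) / z) ^ 2)) ht.ne'
  rw [zero_mul, one_mul] at h
  have ht0 : (t : ℂ) ≠ 0 := by exact_mod_cast ht.ne'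
  have h2 : ∀ s : ℝ, ((s * t : ℝ) : ℂ) ^ (2 * N - 1) / (1 + (((s * t : ℝ) : ℂ) / z) ^ 2) =
      (t : ℂ) ^ (2 * N - 1)
        * ((s : ℂ) ^ (2 * N - 1) / (1 + ((s : ℂ) * (t : ℂ) / z) ^ 2)) := by
    intro s
    push_cast
    rw [mul_pow]
    ring
  simp only [h2] at h
  rw [intervalIntegral.integral_const_mul, Complex.real_smul] at h
  have h3 : (t : ℂ) ^ (2 * N) = (t : ℂ) ^ (2 * N - 1) * t := by
    rw [← pow_succ]; congr 1; omega
  rw [h3]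
  push_cast at h
  calc _ = t * ((t : ℂ) ^ (2 * N - 1) * ∫ s in (0 : ℝ)..1,
        (s : ℂ) ^ (2 * N - 1) / (1 + ((s : ℂ) * (t : ℂ) / z) ^ 2)) := by ring
    _ = _ := by rw [h, mul_inv_cancel_left₀ ht0]

theorem norm_integral_pow_div_le {z : ℂ} (hz : 0 < z.re) (m : ℕ) {t : ℝ} (ht : 0 ≤ t) :
    ‖∫ x in (0 : ℝ)..t, (x : ℂ) ^ m / (1 + ((x : ℂ) / z) ^ 2)‖ ≤
      ‖z‖ ^ 2 / z.re ^ 2 * t ^ (m + 1) := by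
  have h := intervalIntegral.norm_integral_le_of_norm_le_const (a := 0) (b := t)
    (f := fun x : ℝ => (x : ℂ) ^ m / (1 + ((x : ℂ) / z) ^ 2))
    (C := ‖z‖ ^ 2 / z.re ^ 2 * t ^ m) fun x hx => by
      rw [uIoc_of_le ht] at hx
      refine (norm_pow_div_one_add_sq_le hz m hx.1.le).trans ?_
      have := hx.1.le
      have := hx.2
      gcongr
  rw [sub_zero, abs_of_nonneg ht, mul_assoc, ← pow_succ] at h
  exact h

theorem integrableOn_primitive_mul_log {z : ℂ} (hz : 0 < z.re) (m : ℕ) :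
    IntegrableOn (fun t : ℝ => (∫ x in (0 : ℝ)..t, (x : ℂ) ^ m / (1 + ((x : ℂ) / z) ^ 2))
      * (Real.log (1 - Real.exp (-2 * Real.pi * t)) : ℂ)) (Ioi 0) := by
  have hpi := Real.pi_pos
  have hc : Continuous fun t : ℝ => ∫ x in (0 : ℝ)..t, (x : ℂ) ^ m / (1 + ((x : ℂ) / z) ^ 2) :=
    intervalIntegral.continuous_primitive
      (fun a b => (continuous_pow_div_one_add_sq hz m).intervalIntegrable a b) 0
  refine ((integrableOn_pow_mul_exp_neg m Real.pi_pos).const_mul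
    (‖z‖ ^ 2 / z.re ^ 2 / (2 * Real.pi))).mono'
    (hc.aestronglyMeasurable.mul (Measurable.aestronglyMeasurable (by fun_prop))) ?_
  filter_upwards [ae_restrict_mem measurableSet_Ioi] with t ht
  have ht : 0 < t := ht
  rw [norm_mul, Complex.norm_real, Real.norm_eq_abs]
  calc _ ≤ ‖z‖ ^ 2 / z.re ^ 2 * t ^ (m + 1) * (Real.exp (-(Real.pi * t)) / (2 * Real.pi * t)) :=
        mul_le_mul (norm_integral_pow_div_le hz m ht.le) (abs_log_one_sub_exp_le ht)
          (abs_nonneg _) (by positivity)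
    _ = _ := by rw [pow_succ t m]; field_simp

/-- Integration by parts with `d/dt Li₂(e^{-2πt}) = 2π log(1 - e^{-2πt})`. -/
theorem integral_mul_dilog_eq_neg_integral_mul_log {z : ℂ} (hz : 0 < z.re) (m : ℕ) :
    ∫ t in Ioi (0 : ℝ), (t : ℂ) ^ m / (1 + ((t : ℂ) / z) ^ 2)
        * dilog (Real.exp (-2 * Real.pi * t) : ℂ) =
      -(2 * Real.pi) * ∫ t in Ioi (0 : ℝ),
        (∫ x in (0 : ℝ)..t, (x : ℂ) ^ m / (1 + ((x : ℂ) / z) ^ 2))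
          * (Real.log (1 - Real.exp (-2 * Real.pi * t)) : ℂ) := by
  set φ : ℝ → ℂ := fun t => ∫ x in (0 : ℝ)..t, (x : ℂ) ^ m / (1 + ((x : ℂ) / z) ^ 2) with hφ
  obtain ⟨C, hC0, hC⟩ := exists_norm_dilog_exp_le
  have hcont := continuous_pow_div_one_add_sq hz m
  have hbound : ∀ t : ℝ, 0 ≤ t → ‖φ t * dilog (Real.exp (-2 * Real.pi * t) : ℂ)‖ ≤
      ‖z‖ ^ 2 / z.re ^ 2 * C * (t ^ (m + 1) * Real.exp (-(2 * Real.pi * t))) := by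
    intro t ht
    rw [norm_mul]
    calc _ ≤ ‖z‖ ^ 2 / z.re ^ 2 * t ^ (m + 1) * (C * Real.exp (-(2 * Real.pi * t))) :=
          mul_le_mul (norm_integral_pow_div_le hz m ht) (hC t ht) (norm_nonneg _) (by positivity)
      _ = _ := by ring
  have h := integral_Ioi_mul_deriv_eq_deriv_mul (a := (0 : ℝ)) (a' := (0 : ℂ)) (b' := (0 : ℂ))
    (u := φ) (u' := fun t : ℝ => (t : ℂ) ^ m / (1 + ((t : ℂ) / z) ^ 2))
    (v := fun t : ℝ => dilog (Real.exp (-2 * Real.pi * t) : ℂ))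
    (v' := fun t : ℝ => 2 * Real.pi * (Real.log (1 - Real.exp (-2 * Real.pi * t)) : ℂ))
    (fun t _ => hcont.integral_hasStrictDerivAt 0 t |>.hasDerivAt)
    (fun t ht => hasDerivAt_dilog_exp ht) ?_ (integrableOn_pow_div_mul_dilog hz m) ?_ ?_
  · have e : ∀ t : ℝ, φ t * (2 * Real.pi * (Real.log (1 - Real.exp (-2 * Real.pi * t)) : ℂ)) =
        2 * Real.pi * (φ t * (Real.log (1 - Real.exp (-2 * Real.pi * t)) : ℂ)) := fun t => by ring
    simp only [e] at h
    rw [integral_const_mul] at h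
    linear_combination h
  · refine IntegrableOn.congr_fun
      ((integrableOn_primitive_mul_log hz m).const_mul (2 * Real.pi : ℂ))
      (fun t _ => ?_) measurableSet_Ioi
    simp only [Pi.mul_apply, hφ]
    ring
  · refine squeeze_zero_norm' (f := φ * _) (a := fun t : ℝ => ‖z‖ ^ 2 / z.re ^ 2 * C
      * (t ^ (m + 1) * Real.exp (-(2 * Real.pi * t)))) ?_ ?_
    · filter_upwards [self_mem_nhdsWithin] with t ht using hbound t (le_of_lt ht)
    · refine Filter.Tendsto.mono_left ?_ nhdsWithin_le_nhds
      have : Continuous fun t : ℝ => ‖z‖ ^ 2 / z.re ^ 2 * C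
        * (t ^ (m + 1) * Real.exp (-(2 * Real.pi * t))) := by fun_prop
      simpa using this.tendsto 0
  · refine squeeze_zero_norm' (f := φ * _) (a := fun t : ℝ => ‖z‖ ^ 2 / z.re ^ 2 * C
      * (t ^ (m + 1) * Real.exp (-(2 * Real.pi * t)))) ?_ ?_
    · filter_upwards [Filter.eventually_ge_atTop 0] with t ht using hbound t ht
    · have h := tendsto_rpow_mul_exp_neg_mul_atTop_nhds_zero ((m + 1 : ℕ) : ℝ) (2 * Real.pi)
        (by positivity)
      simp only [Real.rpow_natCast, neg_mul] at h
      simpa using h.const_mul (‖z‖ ^ 2 / z.re ^ 2 * C)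

theorem theorem1 (N : ℕ) (hN : 1 ≤ N) (z : ℂ) (hz : z ≠ 0) :
    (|Complex.arg z| < Real.pi / 2 →
      ((∀ t : ℝ, 0 < t → IntervalIntegrable
            (fun s : ℝ => (s : ℂ) ^ (2 * N - 1) / (1 + ((s : ℂ) * (t : ℂ) / z) ^ 2)) volume 0 1)
        ∧ IntegrableOn (fun t : ℝ =>
            (∫ s in (0 : ℝ)..1, (s : ℂ) ^ (2 * N - 1) / (1 + ((s : ℂ) * (t : ℂ) / z) ^ 2))
              * (t : ℂ) ^ (2 * N) * (Real.log (1 - Real.exp (-2 * Real.pi * t)) : ℂ)) (Ioi 0)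
        ∧ barnesRemainder N z = 1 / z ^ (2 * N) * ((-1) ^ (N + 1) / (Real.pi : ℂ))
            * ∫ t in Ioi (0 : ℝ),
                (∫ s in (0 : ℝ)..1, (s : ℂ) ^ (2 * N - 1) / (1 + ((s : ℂ) * (t : ℂ) / z) ^ 2))
                  * (t : ℂ) ^ (2 * N) * (Real.log (1 - Real.exp (-2 * Real.pi * t)) : ℂ))
      ∧ (IntegrableOn (fun t : ℝ => (t : ℂ) ^ (2 * N - 1) / (1 + ((t : ℂ) / z) ^ 2)
              * dilog (Real.exp (-2 * Real.pi * t) : ℂ)) (Ioi 0)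
        ∧ barnesRemainder N z = 1 / z ^ (2 * N) * ((-1) ^ N / (2 * (Real.pi : ℂ) ^ 2))
            * ∫ t in Ioi (0 : ℝ), (t : ℂ) ^ (2 * N - 1) / (1 + ((t : ℂ) / z) ^ 2)
                * dilog (Real.exp (-2 * Real.pi * t) : ℂ)))
    ∧ (|Complex.arg z| < Real.pi →
      (IntegrableOn (fun t : ℝ => (bernoulliFun (2 * N + 1) (t - ⌊t⌋) : ℂ)
              / ((t : ℂ) + z) ^ (2 * N)) (Ioi 0)
        ∧ barnesRemainder N z = -(1 / (2 * (N : ℂ) * (2 * (N : ℂ) + 1)))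
            * ∫ t in Ioi (0 : ℝ), (bernoulliFun (2 * N + 1) (t - ⌊t⌋) : ℂ)
                / ((t : ℂ) + z) ^ (2 * N))
      ∧ (IntegrableOn (fun t : ℝ =>
              (-(bernoulli (2 * N + 2) : ℂ) + (bernoulliFun (2 * N + 2) (t - ⌊t⌋) : ℂ))
                / ((t : ℂ) + z) ^ (2 * N + 1)) (Ioi 0)
        ∧ barnesRemainder N z = -(1 / ((2 * (N : ℂ) + 1) * (2 * (N : ℂ) + 2)))
            * ∫ t in Ioi (0 : ℝ),
                (-(bernoulli (2 * N + 2) : ℂ) + (bernoulliFun (2 * N + 2) (t - ⌊t⌋) : ℂ))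
                  / ((t : ℂ) + z) ^ (2 * N + 1))) := by
  refine ⟨fun harg => ?_, fun harg => ?_⟩
  · have hre : 0 < z.re := (abs_arg_lt_pi_div_two_iff.1 harg).resolve_right hz
    have hlog : ∀ t ∈ Ioi (0 : ℝ),
        (∫ s in (0 : ℝ)..1, (s : ℂ) ^ (2 * N - 1) / (1 + ((s : ℂ) * (t : ℂ) / z) ^ 2))
          * (t : ℂ) ^ (2 * N) * (Real.log (1 - Real.exp (-2 * Real.pi * t)) : ℂ) =
        (∫ x in (0 : ℝ)..t, (x : ℂ) ^ (2 * N - 1) / (1 + ((x : ℂ) / z) ^ 2))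
          * (Real.log (1 - Real.exp (-2 * Real.pi * t)) : ℂ) := fun t ht => by
      rw [integral_zero_one_mul_pow N hN ht]
    refine ⟨⟨fun t ht => ?_, ?_, ?_⟩, integrableOn_pow_div_mul_dilog hre _,
      barnesRemainder_eq_integral_dilog hN hre⟩
    · refine Continuous.intervalIntegrable (Continuous.div (by fun_prop) (by fun_prop)
        fun s => ?_) 0 1
      have := one_add_div_sq_ne_zero hre (s * t)
      push_cast at this
      exact this
    · exact (integrableOn_primitive_mul_log hre _).congr_fun (fun t ht => (hlog t ht).symm)
        measurableSet_Ioi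
    · rw [setIntegral_congr_fun measurableSet_Ioi hlog, barnesRemainder_eq_integral_dilog hN hre,
        integral_mul_dilog_eq_neg_integral_mul_log hre, pow_succ (-1 : ℂ) N]
      have hpi : (Real.pi : ℂ) ≠ 0 := by exact_mod_cast Real.pi_ne_zero
      generalize ∫ t in Ioi (0 : ℝ), (∫ x in (0 : ℝ)..t,
          (x : ℂ) ^ (2 * N - 1) / (1 + ((x : ℂ) / z) ^ 2))
        * (Real.log (1 - Real.exp (-2 * Real.pi * t)) : ℂ) = J
      field_simp
  · have hs : z ∈ slitPlane :=
      mem_slitPlane_iff_arg.2 ⟨fun h => by rw [h, abs_of_pos Real.pi_pos] at harg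
                                           exact lt_irrefl _ harg, hz⟩
    exact ⟨⟨integrableOn_bernoulliFun_fract_div _ hs (by omega),
      barnesRemainder_eq_integral_odd hN hs⟩,
      integrableOn_bernoulliFun_sub_div _ _ hs (by omega),
      barnesRemainder_eq_integral_even hN hs⟩
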